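/- Let $n\ge 0$ and $m\ge 1$ be integers and let $\mathcal Q=[-1,1]^n$ with Lebesgue measure. Let $p(q,s)=\sum_{k=0}^m p_k(q)s^k$ with $p_k\in\mathbb R[q]=\mathbb R[q_1,\dots,q_n]$ and $p_m\equiv 1$, and let $$a(q)=\max\{\Re s : s\in\mathbb C,\ p(q,s)=0\},\qquad q\in\mathcal Q,$$ be its abscissa. Consider real variables $z=(q,x,y)$, where $q=(q_1,\dots,q_n)$, $x=(x_1,\dots,x_m)$, and $y$ consists of the $\lceil m/2\rceil$ variables $y_2,y_4,\dots,y_{2\lfloor m/2\rfloor},y_m$. The remaining $y_k$ are abbreviations: $y_{k-1}:=-y_k$ for every even $k\le m$ if $m$ is even; and, if $m\geq 3$ is odd, $y_{k-1}:=-y_k$ for every even $k\le m-3$ and $y_{m-2}:=-y_{m-1}-y_m$. Put $s_l=x_l+iy_l$ for $l=1,\dots,m$ and $e_k(z)=\sum_{1\le l_1<\dots<l_k\le m}s_{l_1}\cdots s_{l_k}$, and let $$\mathcal Z_o=\{z : q\in\mathcal Q,\ x_k\le x_m\ (1\le k\le m-1),\ p_{m-k}(q)=(-1)^k e_k(z)\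 (1\le k\le m)\}.$$ For $d\in\mathbb N$ with $d\ge 1$ and $2d\ge m$ let $\rho_d$ be the supremum of $\int_{\mathcal Q}w(q)\,dq$ over all $w\in\mathbb R[q]$ of degree at most $2d$ that are feasible, i.e. for which there are $\sigma_0,\sigma_j,\sigma_{x_k},\tau_{\Re,k},\tau_{\Im,k}\in\mathbb R[z]$ such that $$x_m-w(q)=\sigma_0+\sum_{j=1}^n\sigma_j(1-q_j^2)+\sum_{k=1}^{m-1}\sigma_{x_k}(x_m-x_k)+\sum_{k=1}^m\tau_{\Re,k}\big((-1)^kp_{m-k}(q)-\Re e_k(z)\big)+\sum_{k=1}^m\tau_{\Im,k}\,\Im e_k(z)$$ for all real $z$, where $\sigma_0,\sigma_{x_k}$ are sums of squares of degree at most $2d$, the $\sigma_j$ are sums of squares of degree at most $2d-2$, and $\tau_{\Re,k},\tau_{\Im,k}$ have degree at most $2d-k$. Call a feasible $w$ near optimal of order $d$ if $\int_{\mathcal Q}w(q)\,dq\ge\rho_d-\frac1d$. Then: 1. For every $q\in\mathcal Q$ there is a point of $\mathcal Z_o$ with first component $q$, and every such point satisfies $x_m=a(q)$. 2. $a\in L^1(\mathcal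 Q)$, and there is $D$ (with $D\ge1$, $2D\ge m$) such that for all $d\ge D$ feasible polynomials exist, $\rho_d$ is finite, and a near optimal polynomial of order $d$ exists. 3. If $d_0\ge D$ and $w_d$ is near optimal of order $d$ for every $d\ge d_0$, then $w_d\le a$ on $\mathcal Q$ for every $d\ge d_0$, and $\lim_{d\to\infty}\int_{\mathcal Q}|w_d(q)-a(q)|\,dq=0$. -/

import Mathlib

open MeasureTheory Filter Topology

noncomputable section

namespace AbscissaLower

/-- The parameter box `[-1, 1]^n`. -/
def box (n : ℕ) : Set (Fin n → ℝ) := Set.Icc (fun _ => -1) (fun _ => 1)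

/-- The complex polynomial `p(q, ·)` obtained by specialising the parameters to `q`. -/
def specialise {n : ℕ} (p : Polynomial (MvPolynomial (Fin n) ℝ)) (q : Fin n → ℝ) :
    Polynomial ℂ :=
  p.map ((algebraMap ℝ ℂ).comp (MvPolynomial.eval q))

/-- The abscissa `a(q)`: the largest real part of a complex root of `p(q, ·)`. -/
def abscissa {n : ℕ} (p : Polynomial (MvPolynomial (Fin n) ℝ)) (q : Fin n → ℝ) : ℝ :=
  sSup (Complex.re '' {s : ℂ | (specialise p q).IsRoot s})

/-- Indices of the retained imaginary parts `y_2, y_4, …, y_{2⌊m/2⌋}, y_m`.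
The indices of `Fin m` start at `0`, so the index `k` stands for `y_{k+1}`. -/
abbrev YIdx (m : ℕ) : Type := {k : Fin m // Odd (k : ℕ) ∨ (k : ℕ) + 1 = m}

/-- Names of the variables `q_j`, `x_k` and the retained `y_k`. -/
abbrev Var (n m : ℕ) : Type := Fin n ⊕ (Fin m ⊕ YIdx m)

/-- The `q`-part of a point. -/
def qPart {n m : ℕ} (z : Var n m → ℝ) : Fin n → ℝ := fun j => z (Sum.inl j)

/-- The `x`-part of a point. -/
def xPart {n m : ℕ} (z : Var n m → ℝ) : Fin m → ℝ := fun k => z (Sum.inr (Sum.inl k))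

/-- All imaginary parts `y_1, …, y_m` of a point: the eliminated ones are
`y_{k-1} = -y_k` for even `k`, except that `y_{m-2} = -y_{m-1} - y_m` when `m ≥ 3` is odd. -/
def yPart {n m : ℕ} (z : Var n m → ℝ) (k : Fin m) : ℝ :=
  if h : Odd (k : ℕ) ∨ (k : ℕ) + 1 = m then z (Sum.inr (Sum.inr ⟨k, h⟩))
  else
    have hk : (k : ℕ) + 1 < m := by have := k.isLt; omega
    have ho : Odd ((k : ℕ) + 1) := by
      rw [not_or, Nat.not_odd_iff_even] at h
      exact h.1.add_one
    if h3 : (k : ℕ) + 3 = m then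
      - z (Sum.inr (Sum.inr ⟨⟨(k : ℕ) + 1, hk⟩, Or.inl ho⟩))
        - z (Sum.inr (Sum.inr ⟨⟨(k : ℕ) + 2, by omega⟩, Or.inr h3⟩))
    else - z (Sum.inr (Sum.inr ⟨⟨(k : ℕ) + 1, hk⟩, Or.inl ho⟩))

/-- The complex numbers `s_k = x_k + i y_k` encoded by a point. -/
def sPart {n m : ℕ} (z : Var n m → ℝ) (k : Fin m) : ℂ :=
  (xPart z k : ℂ) + (yPart z k : ℂ) * Complex.I

/-- The `k`-th elementary symmetric function `∑_{l_1 < ⋯ < l_k} s_{l_1} ⋯ s_{l_k}`. -/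
def elemSymm {n m : ℕ} (k : ℕ) (z : Var n m → ℝ) : ℂ :=
  ∑ t ∈ (Finset.univ : Finset (Fin m)).powersetCard k, ∏ l ∈ t, sPart z l

/-- The index of `x_m`. -/
def lastIdx {m : ℕ} (hm : 0 < m) : Fin m := ⟨m - 1, Nat.sub_lt hm Nat.one_pos⟩

/-- The set `Z_o`. -/
def rootSet {n m : ℕ} (hm : 0 < m) (p : Polynomial (MvPolynomial (Fin n) ℝ)) :
    Set (Var n m → ℝ) :=
  {z | qPart z ∈ box n ∧
    (∀ k : Fin m, k ≠ lastIdx hm → xPart z k ≤ xPart z (lastIdx hm)) ∧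
    ∀ k ∈ Finset.Icc 1 m,
      ((MvPolynomial.eval (qPart z) (p.coeff (m - k)) : ℝ) : ℂ) = (-1) ^ k * elemSymm k z}

/-- Membership in the cone of sums of squares of degree at most `D`. -/
def IsSOS {ι : Type} (D : ℕ) (f : MvPolynomial ι ℝ) : Prop :=
  IsSumSq f ∧ f.totalDegree ≤ D

/-- `w` is (the first component of) a feasible point of the semidefinite program of order `d`.
It is used for `1 ≤ d` and `m ≤ 2 * d` only, so that no subtraction below truncates. -/
def IsFeasible {n m : ℕ} (hm : 0 < m) (p : Polynomial (MvPolynomial (Fin n) ℝ)) (d : ℕ)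
    (w : MvPolynomial (Fin n) ℝ) : Prop :=
  w.totalDegree ≤ 2 * d ∧
  ∃ (σ₀ : MvPolynomial (Var n m) ℝ) (σ : Fin n → MvPolynomial (Var n m) ℝ)
    (σx : Fin m → MvPolynomial (Var n m) ℝ) (τRe τIm : ℕ → MvPolynomial (Var n m) ℝ),
    IsSOS (2 * d) σ₀ ∧
    (∀ j, IsSOS (2 * d - 2) (σ j)) ∧
    (∀ k, k ≠ lastIdx hm → IsSOS (2 * d) (σx k)) ∧
    (∀ k ∈ Finset.Icc 1 m, (τRe k).totalDegree ≤ 2 * d - k) ∧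
    (∀ k ∈ Finset.Icc 1 m, (τIm k).totalDegree ≤ 2 * d - k) ∧
    ∀ z : Var n m → ℝ,
      xPart z (lastIdx hm) - MvPolynomial.eval (qPart z) w =
        MvPolynomial.eval z σ₀
        + ∑ j : Fin n, MvPolynomial.eval z (σ j) * (1 - qPart z j ^ 2)
        + ∑ k ∈ Finset.univ.erase (lastIdx hm),
            MvPolynomial.eval z (σx k) * (xPart z (lastIdx hm) - xPart z k)
        + ∑ k ∈ Finset.Icc 1 m, MvPolynomial.eval z (τRe k) *
            ((-1) ^ k * MvPolynomial.eval (qPart z) (p.coeff (m - k)) - (elemSymm k z).re)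
        + ∑ k ∈ Finset.Icc 1 m, MvPolynomial.eval z (τIm k) * (elemSymm k z).im

/-- The objective `∫_Q w(q) dq`. -/
def objective {n : ℕ} (w : MvPolynomial (Fin n) ℝ) : ℝ :=
  ∫ q in box n, MvPolynomial.eval q w

/-- The set of objective values of the program of order `d`. -/
def values {n m : ℕ} (hm : 0 < m) (p : Polynomial (MvPolynomial (Fin n) ℝ)) (d : ℕ) : Set ℝ :=
  objective '' {w | IsFeasible hm p d w}

/-- The optimal value `ρ_d` of the program of order `d`. -/
def optVal {n m : ℕ} (hm : 0 < m) (p : Polynomial (MvPolynomial (Fin n) ℝ)) (d : ℕ) : ℝ :=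
  sSup (values hm p d)

/-- Near optimality: feasible, with objective at least `ρ_d - 1/d`. -/
def IsNearOptimal {n m : ℕ} (hm : 0 < m) (p : Polynomial (MvPolynomial (Fin n) ℝ)) (d : ℕ)
    (w : MvPolynomial (Fin n) ℝ) : Prop :=
  IsFeasible hm p d w ∧ optVal hm p d - 1 / (d : ℝ) ≤ objective w

end AbscissaLower

end

namespace AbscissaLower

/-! A certificate is nonnegative on `rootSet`: the weights of the inequalities are sums of squares
and the equations vanish there. Every `q` in the box lifts to `rootSet`, where `x_m` is the
abscissa, so a feasible `w` lies below `a` and its L¹ distance to `a` is `∫ a - objective w`. It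
remains to show that the optimal values tend to `∫ a`.

The abscissa is continuous on the box, so Stone–Weierstrass yields polynomials strictly below `a`
and uniformly close to it. For such a `w`, `x_m - w` is positive on `rootSet`, and Putinar's theorem
(`mem_of_pos`) gives a certificate, which meets the degree bounds for all large `d`.

Putinar's theorem needs an Archimedean quadratic module, although no ball constraint is present
(`archimedean_certModule`). The equations force each `s_l` to be a root of the monic polynomial
`p(q, ·)`, whose coefficients are bounded because `1 - q_j²` is in the module; the classical root
bound is then carried out inside the module (`exists_sub_norm_sq_mem`).

Lifting (`exists_mem_rootSet`) must respect the eliminated `y_k`. A real polynomial splits into real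
quadratics, and one linear factor in odd degree; the imaginary parts of the roots of each real
factor sum to zero. The block containing a rightmost root goes last: a quadratic for even `m`, a
cubic for odd `m ≥ 3`, whence the exceptional relation for `y_{m-2}`. -/

theorem isSumSq_pow {A : Type*} [CommRing A] {T : A} (hT : IsSumSq T) (i : ℕ) :
    IsSumSq (T ^ i) := by
  induction i with
  | zero => simp
  | succ i ih => rw [pow_succ]; exact ih.mul hT

/-- A quadratic module of a commutative ring. -/
structure IsQuadModule {A : Type*} [CommRing A] (M : Set A) : Prop where
  one_mem : (1 : A) ∈ M
  add_mem : ∀ {f g}, f ∈ M → g ∈ M → f + g ∈ M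
  sq_mul_mem : ∀ (a) {f}, f ∈ M → a ^ 2 * f ∈ M

/-! ### Quadratic modules and the Archimedean Positivstellensatz -/

namespace IsQuadModule

variable {A : Type*} [CommRing A] {M : Set A}

theorem zero_mem (hM : IsQuadModule M) : (0 : A) ∈ M := by
  simpa using hM.sq_mul_mem 0 hM.one_mem

theorem sq_mem (hM : IsQuadModule M) (a : A) : a ^ 2 ∈ M := by
  simpa using hM.sq_mul_mem a hM.one_mem

theorem sum_mem (hM : IsQuadModule M) {ι : Type*} (s : Finset ι) {f : ι → A}
    (h : ∀ i ∈ s, f i ∈ M) : ∑ i ∈ s, f i ∈ M := by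
  classical
  induction s using Finset.induction_on with
  | empty => simpa using hM.zero_mem
  | insert i s hi ih =>
    rw [Finset.sum_insert hi]
    exact hM.add_mem (h i (by simp)) (ih fun j hj => h j (by simp [hj]))

theorem sumSq_mul_mem (hM : IsQuadModule M) {s : A} (hs : IsSumSq s) {f : A} (hf : f ∈ M) :
    s * f ∈ M := by
  induction hs with
  | zero => simpa using hM.zero_mem
  | sq_add a _ ih =>
    rw [add_mul, ← pow_two]
    exact hM.add_mem (hM.sq_mul_mem a hf) ih

theorem sumSq_mem (hM : IsQuadModule M) {s : A} (hs : IsSumSq s) : s ∈ M := by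
  simpa using hM.sumSq_mul_mem hs hM.one_mem

/-- The quadratic module generated by a quadratic module and one more element. -/
theorem adjoin (hM : IsQuadModule M) (g : A) :
    IsQuadModule {f : A | ∃ u ∈ M, ∃ s, IsSumSq s ∧ f = u + s * g} where
  one_mem := ⟨1, hM.one_mem, 0, .zero, by simp⟩
  add_mem := by
    rintro _ _ ⟨u, hu, s, hs, rfl⟩ ⟨v, hv, t, ht, rfl⟩
    exact ⟨u + v, hM.add_mem hu hv, s + t, hs.add ht, by ring⟩
  sq_mul_mem := by
    rintro a _ ⟨u, hu, s, hs, rfl⟩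
    exact ⟨a ^ 2 * u, hM.sq_mul_mem a hu, a ^ 2 * s,
      (IsSquare.sq a).isSumSq.mul hs, by ring⟩

variable [Algebra ℝ A]

theorem smul_mem (hM : IsQuadModule M) {r : ℝ} (hr : 0 ≤ r) {f : A} (hf : f ∈ M) :
    r • f ∈ M := by
  have := hM.sq_mul_mem (algebraMap ℝ A (Real.sqrt r)) hf
  rwa [← map_pow, Real.sq_sqrt hr, ← Algebra.smul_def] at this

theorem const_mem (hM : IsQuadModule M) {r : ℝ} (hr : 0 ≤ r) : algebraMap ℝ A r ∈ M := by
  simpa [Algebra.smul_def] using hM.smul_mem hr hM.one_mem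

theorem nonneg_of_const_mem (hM : IsQuadModule M) (h1 : (-1 : A) ∉ M) {r : ℝ}
    (hr : algebraMap ℝ A r ∈ M) : 0 ≤ r := by
  by_contra! h
  apply h1
  have := hM.smul_mem (r := (-r)⁻¹) (by rw [inv_nonneg]; linarith) hr
  rw [Algebra.smul_def, ← map_mul] at this
  convert this using 1
  rw [inv_neg, neg_mul, inv_mul_cancel₀ h.ne, map_neg, map_one]

/-- The support of a quadratic module is an ideal. -/
theorem support_mul_mem (hM : IsQuadModule M) {f : A} (hf : f ∈ M) (hf' : -f ∈ M) (a : A) :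
    a * f ∈ M := by
  -- Uses `4a = (a + 1)² - (a - 1)²`, the negative square being applied to `-f`.
  have h1 := hM.smul_mem (r := 1 / 4) (by norm_num) (hM.sq_mul_mem (a + 1) hf)
  have h2 := hM.smul_mem (r := 1 / 4) (by norm_num) (hM.sq_mul_mem (a - 1) hf')
  convert hM.add_mem h1 h2 using 1
  rw [← smul_add]
  have : (a + 1) ^ 2 * f + (a - 1) ^ 2 * -f = (4 : ℝ) • (a * f) := by
    rw [Algebra.smul_def, map_ofNat]; ring
  rw [this, smul_smul]; norm_num

/-- A maximal proper quadratic module is a semiordering. -/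
theorem mem_or_neg_mem_of_maximal
    (hM : Maximal (fun S : Set A => IsQuadModule S ∧ (-1 : A) ∉ S) M) (f : A) :
    f ∈ M ∨ -f ∈ M := by
  have hQ := hM.prop.1
  have key : ∀ g : A, g ∉ M → ∃ u ∈ M, ∃ s, IsSumSq s ∧ (-1 : A) = u + s * g := by
    intro g hg
    by_contra hcon
    have hle := hM.le_of_ge (y := {f : A | ∃ u ∈ M, ∃ s, IsSumSq s ∧ f = u + s * g})
      ⟨hQ.adjoin g, hcon⟩ (fun u hu => ⟨u, hu, 0, .zero, by simp⟩)
    exact hg (hle ⟨0, hQ.zero_mem, 1, IsSumSq.one, by simp⟩)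
  by_contra! hcon
  obtain ⟨u, hu, s, hs, h1⟩ := key f hcon.1
  obtain ⟨v, hv, t, ht, h2⟩ := key (-f) hcon.2
  -- Eliminating `f` from the two representations of `-1` shows that `s` is in the support, an
  -- ideal; then `s * f ∈ M`, and `-1 = u + s * f` contradicts properness.
  have hs' : -s ∈ M := by
    have : -s = t + t * u + s * v := by linear_combination t * h1 + s * h2
    rw [this]
    exact hQ.add_mem (hQ.add_mem (hQ.sumSq_mem ht) (hQ.sumSq_mul_mem ht hu))
      (hQ.sumSq_mul_mem hs hv)
  apply hM.prop.2
  rw [h1, mul_comm]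
  exact hQ.add_mem hu (hQ.support_mul_mem (hQ.sumSq_mem hs) hs' f)

/-- The element `a` is infinitely close to the real number `c`, with respect to `M`. -/
def Near (M : Set A) (a : A) (c : ℝ) : Prop :=
  ∀ ε : ℝ, 0 < ε → algebraMap ℝ A ε + (a - algebraMap ℝ A c) ∈ M ∧
    algebraMap ℝ A ε - (a - algebraMap ℝ A c) ∈ M

theorem Near.unique (hM : IsQuadModule M) (h1 : (-1 : A) ∉ M) {a : A} {c d : ℝ}
    (hc : Near M a c) (hd : Near M a d) : c = d := by
  have key : ∀ {c d : ℝ}, Near M a c → Near M a d → c ≤ d := by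
    intro c d hc hd
    refine le_of_forall_pos_le_add fun ε hε => ?_
    have := hM.add_mem (hc (ε / 2) (half_pos hε)).1 (hd (ε / 2) (half_pos hε)).2
    have h2 : algebraMap ℝ A (ε / 2) + (a - algebraMap ℝ A c) +
        (algebraMap ℝ A (ε / 2) - (a - algebraMap ℝ A d)) = algebraMap ℝ A (d + ε - c) := by
      have : d + ε - c = ε / 2 - c + ε / 2 + d := by ring
      rw [this]; simp only [map_add, map_sub]; ring
    rw [h2] at this
    linarith [hM.nonneg_of_const_mem h1 this]
  exact le_antisymm (key hc hd) (key hd hc)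

theorem near_const (hM : IsQuadModule M) (c : ℝ) : Near M (algebraMap ℝ A c) c := by
  intro ε hε
  simpa using hM.const_mem hε.le

theorem Near.add (hM : IsQuadModule M) {a b : A} {c d : ℝ} (ha : Near M a c)
    (hb : Near M b d) : Near M (a + b) (c + d) := by
  intro ε hε
  have h2 : algebraMap ℝ A ε = algebraMap ℝ A (ε / 2) + algebraMap ℝ A (ε / 2) := by
    rw [← map_add, add_halves]
  obtain ⟨h3, h4⟩ := ha (ε / 2) (half_pos hε)
  obtain ⟨h5, h6⟩ := hb (ε / 2) (half_pos hε)
  constructor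
  · convert hM.add_mem h3 h5 using 1
    rw [h2, map_add]; ring
  · convert hM.add_mem h4 h6 using 1
    rw [h2, map_add]; ring

theorem Near.neg {a : A} {c : ℝ} (ha : Near M a c) : Near M (-a) (-c) := by
  intro ε hε
  obtain ⟨h3, h4⟩ := ha ε hε
  constructor
  · convert h4 using 1; rw [map_neg]; ring
  · convert h3 using 1; rw [map_neg]; ring

theorem Near.smul (hM : IsQuadModule M) {a : A} {c : ℝ} (ha : Near M a c) (r : ℝ) :
    Near M (r • a) (r * c) := by
  have key : ∀ s : ℝ, 0 < s → Near M (s • a) (s * c) := by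
    intro s hs ε hε
    obtain ⟨h3, h4⟩ := ha (ε / s) (div_pos hε hs)
    have h5 : algebraMap ℝ A ε = algebraMap ℝ A s * algebraMap ℝ A (ε / s) := by
      rw [← map_mul, mul_div_cancel₀ _ hs.ne']
    constructor
    · convert hM.smul_mem hs.le h3 using 1
      rw [Algebra.smul_def, Algebra.smul_def, h5, map_mul]; ring
    · convert hM.smul_mem hs.le h4 using 1
      rw [Algebra.smul_def, Algebra.smul_def, h5, map_mul]; ring
  rcases lt_trichotomy r 0 with h | rfl | h
  · simpa using (key (-r) (by linarith)).neg
  · simpa using near_const hM (0 : ℝ)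
  · exact key r h

/-- With `δ = √ε`, the upper bound comes from `2δ(δ² - a²) = (δ - a)²(δ + a) + (δ + a)²(δ - a)`,
which needs no product of two members of `M`. -/
theorem Near.sq_zero (hM : IsQuadModule M) {a : A} (ha : Near M a 0) : Near M (a ^ 2) 0 := by
  intro ε hε
  have hs := Real.sqrt_pos.2 hε
  set δ := Real.sqrt ε with hδ
  have hε' : ε = δ ^ 2 := (Real.sq_sqrt hε.le).symm
  refine ⟨by simpa using hM.add_mem (hM.const_mem hε.le) (hM.sq_mem a), ?_⟩
  obtain ⟨h3, h4⟩ := ha δ hs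
  have h5 := hM.smul_mem (r := 1 / (2 * δ)) (by positivity)
    (hM.add_mem (hM.sq_mul_mem (algebraMap ℝ A δ - a) h3)
      (hM.sq_mul_mem (algebraMap ℝ A δ + a) h4))
  convert h5 using 1
  have h6 : (algebraMap ℝ A δ - a) ^ 2 * (algebraMap ℝ A δ + (a - algebraMap ℝ A 0)) +
      (algebraMap ℝ A δ + a) ^ 2 * (algebraMap ℝ A δ - (a - algebraMap ℝ A 0)) =
      (2 * δ) • (algebraMap ℝ A ε - (a ^ 2 - algebraMap ℝ A 0)) := by
    rw [Algebra.smul_def, hε', map_mul, map_pow, map_zero, map_ofNat]; ring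
  rw [h6, smul_smul, one_div, inv_mul_cancel₀ (by positivity), one_smul]

/-- Polarisation reduces the product of the infinitesimals `a - c` and `b - d` to squares; the rest
is `ab = (a - c)(b - d) + d(a - c) + c(b - d) + cd`. -/
theorem Near.mul (hM : IsQuadModule M) {a b : A} {c d : ℝ} (ha : Near M a c)
    (hb : Near M b d) : Near M (a * b) (c * d) := by
  have ha' : Near M (a - algebraMap ℝ A c) 0 := by
    simpa [← sub_eq_add_neg] using ha.add hM (near_const hM c).neg
  have hb' : Near M (b - algebraMap ℝ A d) 0 := by
    simpa [← sub_eq_add_neg] using hb.add hM (near_const hM d).neg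
  have h1 : Near M ((a - algebraMap ℝ A c + (b - algebraMap ℝ A d)) ^ 2) 0 :=
    Near.sq_zero hM (by simpa using ha'.add hM hb')
  have h2 : Near M ((a - algebraMap ℝ A c - (b - algebraMap ℝ A d)) ^ 2) 0 :=
    Near.sq_zero hM (by simpa only [← sub_eq_add_neg, sub_zero] using ha'.add hM hb'.neg)
  have h3 := ((((h1.add hM h2.neg).smul hM (1 / 4)).add hM (ha'.smul hM d)).add hM
    (hb'.smul hM c)).add hM (near_const hM (c * d))
  convert h3 using 1
  · have : (a - algebraMap ℝ A c + (b - algebraMap ℝ A d)) ^ 2 +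
        -(a - algebraMap ℝ A c - (b - algebraMap ℝ A d)) ^ 2 =
        (4 : ℝ) • ((a - algebraMap ℝ A c) * (b - algebraMap ℝ A d)) := by
      rw [Algebra.smul_def, map_ofNat]; ring
    rw [this, smul_smul, one_div, inv_mul_cancel₀ (by norm_num), one_smul, Algebra.smul_def,
      Algebra.smul_def, map_mul]
    ring
  · ring

/-- The standard part of `a` is the supremum of the reals below it. The Archimedean property makes
the cut proper, and the semiordering property supplies the upper estimate. -/
theorem exists_near_of_maximal
    (hM : Maximal (fun S : Set A => IsQuadModule S ∧ (-1 : A) ∉ S) M)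
    (harch : ∀ a : A, ∃ N : ℝ, algebraMap ℝ A N - a ∈ M) (a : A) : ∃ c, Near M a c := by
  have hQ := hM.prop.1
  set T : Set ℝ := {r | a - algebraMap ℝ A r ∈ M} with hT
  have hne : T.Nonempty := by
    obtain ⟨N, hN⟩ := harch (-a)
    exact ⟨-N, by simpa [hT, add_comm] using hN⟩
  have hbdd : BddAbove T := by
    obtain ⟨N, hN⟩ := harch a
    refine ⟨N, fun r hr => ?_⟩
    have := hQ.add_mem hN hr
    rw [sub_add_sub_cancel, ← map_sub] at this
    linarith [hQ.nonneg_of_const_mem hM.prop.2 this]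
  refine ⟨sSup T, fun ε hε => ⟨?_, ?_⟩⟩
  · obtain ⟨r, hr, hlt⟩ := exists_lt_of_lt_csSup hne (sub_lt_self (sSup T) hε)
    have h0 : 0 ≤ ε - sSup T + r := by linarith
    convert hQ.add_mem hr (hQ.const_mem h0) using 1
    simp only [map_add, map_sub]; ring
  · have hnot : a - algebraMap ℝ A (sSup T + ε) ∉ M := fun h => by
      linarith [le_csSup hbdd (show sSup T + ε ∈ T from h)]
    convert (mem_or_neg_mem_of_maximal hM _).resolve_left hnot using 1
    rw [map_add]; ring

/-- A proper Archimedean quadratic module is nonnegative at some real character. -/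
theorem exists_algHom (hM : IsQuadModule M) (h1 : (-1 : A) ∉ M)
    (harch : ∀ a : A, ∃ N : ℝ, algebraMap ℝ A N - a ∈ M) :
    ∃ φ : A →ₐ[ℝ] ℝ, ∀ f ∈ M, 0 ≤ φ f := by
  obtain ⟨S, hMS, hS⟩ := zorn_subset_nonempty {S : Set A | IsQuadModule S ∧ (-1 : A) ∉ S}
    (fun c hc hchain hne => by
      refine ⟨⋃₀ c, ⟨⟨?_, ?_, ?_⟩, ?_⟩, fun s hs => Set.subset_sUnion_of_mem hs⟩
      · obtain ⟨s, hs⟩ := hne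
        exact ⟨s, hs, (hc hs).1.one_mem⟩
      · rintro f g ⟨s, hs, hf⟩ ⟨t, ht, hg⟩
        rcases hchain.total hs ht with h | h
        · exact ⟨t, ht, (hc ht).1.add_mem (h hf) hg⟩
        · exact ⟨s, hs, (hc hs).1.add_mem hf (h hg)⟩
      · rintro a f ⟨s, hs, hf⟩
        exact ⟨s, hs, (hc hs).1.sq_mul_mem a hf⟩
      · rintro ⟨s, hs, h⟩
        exact (hc hs).2 h) M ⟨hM, h1⟩
  have hS' : Maximal (fun S : Set A => IsQuadModule S ∧ (-1 : A) ∉ S) S := hS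
  have hQ := hS'.prop.1
  choose φ hφ using exists_near_of_maximal hS' fun a => (harch a).imp fun N hN => hMS hN
  have huniq : ∀ {a : A} {c : ℝ}, Near S a c → φ a = c := fun h =>
    (hφ _).unique hQ hS'.prop.2 h
  refine ⟨{ toFun := φ
            map_one' := huniq (by simpa using near_const hQ (1 : ℝ))
            map_mul' := fun a b => huniq ((hφ a).mul hQ (hφ b))
            map_zero' := huniq (by simpa using near_const hQ (0 : ℝ))
            map_add' := fun a b => huniq ((hφ a).add hQ (hφ b))
            commutes' := fun r => huniq (near_const hQ r) }, fun f hf => ?_⟩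
  change 0 ≤ φ f
  refine le_of_forall_pos_le_add fun ε hε => ?_
  have h2 := hQ.add_mem (hMS hf) ((hφ f) ε hε).2
  refine hQ.nonneg_of_const_mem hS'.prop.2 (r := φ f + ε) ?_
  convert h2 using 1
  rw [map_add]; ring

/-- Putinar's Positivstellensatz, in Jacobi's abstract form. -/
theorem mem_of_pos (hM : IsQuadModule M)
    (harch : ∀ a : A, ∃ N : ℝ, algebraMap ℝ A N - a ∈ M) {f : A}
    (hf : ∀ φ : A →ₐ[ℝ] ℝ, (∀ g ∈ M, 0 ≤ φ g) → 0 < φ f) : f ∈ M := by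
  -- Otherwise adjoining `-f` leaves the module proper, and a character nonnegative on it has `φ f ≤
  -- 0`.
  have hex : ∃ s, IsSumSq s ∧ s * f - 1 ∈ M := by
    by_contra! hcon
    have hM' := hM.adjoin (-f)
    obtain ⟨φ, hφ⟩ := hM'.exists_algHom
      (by
        rintro ⟨u, hu, s, hs, h⟩
        refine hcon s hs ?_
        convert hu using 1
        linear_combination h)
      (fun a => (harch a).imp fun N hN => ⟨_, hN, 0, .zero, by simp⟩)
    have h1 := hf φ fun g hg => hφ g ⟨g, hg, 0, .zero, by simp⟩
    have h2 := hφ (-f) ⟨0, hM.zero_mem, 1, IsSumSq.one, by simp⟩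
    rw [map_neg] at h2
    linarith
  obtain ⟨s, hs, hsf⟩ := hex
  obtain ⟨N₁, h1⟩ := harch s
  obtain ⟨N₂, h2⟩ := harch (s ^ 2 * f + 1)
  obtain ⟨k, hk⟩ : ∃ k : ℝ, 0 < k ∧ N₁ ≤ 2 * k ∧ N₂ ≤ 2 * k :=
    ⟨max 1 (max N₁ N₂), by positivity,
      by linarith [le_max_left N₁ N₂, le_max_right 1 (max N₁ N₂), le_max_left 1 (max N₁ N₂)],
      by linarith [le_max_right N₁ N₂, le_max_right 1 (max N₁ N₂), le_max_left 1 (max N₁ N₂)]⟩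
  obtain ⟨hk0, hk1, hk2⟩ := hk
  have h1' : algebraMap ℝ A (2 * k) - s ∈ M := by
    convert hM.add_mem h1 (hM.const_mem (sub_nonneg.2 hk1)) using 1
    rw [map_sub]; ring
  have h2' : algebraMap ℝ A (2 * k) - (s ^ 2 * f + 1) ∈ M := by
    convert hM.add_mem h2 (hM.const_mem (sub_nonneg.2 hk2)) using 1
    rw [map_sub]; ring
  -- The identity `h5` lowers `r` by the fixed amount `1 / k²`; `r ≥ 0` is needed because `r`
  -- multiplies `s(2k - s)`. Finitely many such steps bring the constant down to zero or below.
  have step : ∀ r : ℝ, 0 ≤ r → f + algebraMap ℝ A r ∈ M →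
      f + algebraMap ℝ A (r - 1 / k ^ 2) ∈ M := by
    intro r hr hfr
    have h3 := hM.add_mem (hM.add_mem (hM.add_mem
      (hM.sq_mul_mem (algebraMap ℝ A k - s) hfr)
      (hM.smul_mem (r := 2 * k) (by positivity) hsf))
      (hM.smul_mem hr (hM.sumSq_mul_mem hs h1'))) h2'
    have h4 := hM.smul_mem (r := 1 / k ^ 2) (by positivity) h3
    convert h4 using 1
    have h5 : (algebraMap ℝ A k - s) ^ 2 * (f + algebraMap ℝ A r) + (2 * k) • (s * f - 1) +
        r • (s * (algebraMap ℝ A (2 * k) - s)) + (algebraMap ℝ A (2 * k) - (s ^ 2 * f + 1)) =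
        k ^ 2 • (f + algebraMap ℝ A r) - 1 := by
      simp only [Algebra.smul_def, map_mul, map_pow, map_ofNat]; ring
    rw [h5, smul_sub, smul_smul, one_div, inv_mul_cancel₀ (by positivity), one_smul, map_sub,
      Algebra.smul_def, mul_one]
    ring
  obtain ⟨N, hN⟩ := harch (-f)
  have iter : ∀ j : ℕ, f ∈ M ∨ f + algebraMap ℝ A (N - j * (1 / k ^ 2)) ∈ M := by
    intro j
    induction j with
    | zero => right; simpa [add_comm] using hN
    | succ j ih =>
      rcases ih with h | h
      · exact Or.inl h
      · rcases le_or_gt 0 (N - j * (1 / k ^ 2)) with h0 | h0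
        · right
          convert step _ h0 h using 3
          push_cast; ring
        · left
          convert hM.add_mem h (hM.const_mem (neg_nonneg.2 h0.le)) using 1
          rw [map_neg]; ring
  obtain ⟨j, hj⟩ := exists_nat_gt (N / (1 / k ^ 2))
  rcases iter j with h | h
  · exact h
  · have h0 : N - j * (1 / k ^ 2) ≤ 0 := by
      rw [div_lt_iff₀ (by positivity)] at hj
      linarith
    convert hM.add_mem h (hM.const_mem (neg_nonneg.2 h0)) using 1
    rw [map_neg]; ring

/-- The elements bounded with respect to a quadratic module form a subalgebra. -/
def bounded (hM : IsQuadModule M) : Subalgebra ℝ A where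
  carrier := {a | ∃ N : ℝ, 0 ≤ N ∧ algebraMap ℝ A N - a ^ 2 ∈ M}
  mul_mem' := by
    rintro a b ⟨N, hN, ha⟩ ⟨K, hK, hb⟩
    refine ⟨N * K, by positivity, ?_⟩
    convert hM.add_mem (hM.sq_mul_mem b ha) (hM.smul_mem hN hb) using 1
    rw [Algebra.smul_def, map_mul]; ring
  add_mem' := by
    rintro a b ⟨N, hN, ha⟩ ⟨K, hK, hb⟩
    refine ⟨2 * N + 2 * K, by positivity, ?_⟩
    convert hM.add_mem (hM.smul_mem (zero_le_two) (hM.add_mem ha hb)) (hM.sq_mem (a - b)) using 1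
    simp only [Algebra.smul_def, map_add, map_mul, map_ofNat]; ring
  algebraMap_mem' r := ⟨r ^ 2, by positivity, by simpa using hM.zero_mem⟩

theorem mem_bounded (hM : IsQuadModule M) {a : A} :
    a ∈ hM.bounded ↔ ∃ N : ℝ, 0 ≤ N ∧ algebraMap ℝ A N - a ^ 2 ∈ M := Iff.rfl

theorem exists_sub_mem_of_mem_bounded (hM : IsQuadModule M) {a : A} (ha : a ∈ hM.bounded) :
    ∃ N : ℝ, algebraMap ℝ A N - a ∈ M := by
  obtain ⟨N, -, h⟩ := ha
  -- Completing the square: `N + 1/4 - a = (N - a²) + (a - 1/2)²`.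
  refine ⟨N + 1 / 4, ?_⟩
  convert hM.add_mem h (hM.sq_mem (a - algebraMap ℝ A (1 / 2))) using 1
  have h1 : algebraMap ℝ A (1 / 4) = algebraMap ℝ A (1 / 2) ^ 2 := by
    rw [← map_pow]; norm_num
  have h2 : algebraMap ℝ A (1 / 2) * 2 = 1 := by
    rw [← map_ofNat (algebraMap ℝ A) 2, ← map_mul]; norm_num
  rw [map_add, h1]
  linear_combination a * h2

end IsQuadModule

/-! ### Enumerating the roots of a real polynomial by real factors -/

section RealFactors

open Polynomial

theorem exists_quadratic_factor_isRoot {s : ℂ} : ∀ (r : ℕ) {f : ℝ[X]},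
    IsMonicOfDegree f (2 * r + 2) → aeval s f = 0 →
    ∃ h g : ℝ[X], IsMonicOfDegree h 2 ∧ IsMonicOfDegree g (2 * r) ∧ f = h * g ∧ aeval s h = 0 := by
  intro r
  induction r with
  | zero => exact fun {f} hf hs => ⟨f, 1, hf, by simp, by simp, hs⟩
  | succ r ih =>
    intro f hf hs
    obtain ⟨f₁, f₂, h1, h2, rfl⟩ := hf.eq_isMonicOfDegree_two_mul_isMonicOfDegree
    rw [map_mul, mul_eq_zero] at hs
    rcases hs with hs | hs
    · exact ⟨f₁, f₂, h1, h2, rfl, hs⟩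
    · obtain ⟨h, g, hh, hg, rfl, hs'⟩ := ih h2 hs
      refine ⟨h, f₁ * g, hh, ?_, by ring, hs'⟩
      rw [mul_add, add_comm]
      exact h1.mul hg

theorem exists_linear_factor : ∀ (r : ℕ) {f : ℝ[X]}, IsMonicOfDegree f (2 * r + 1) →
    ∃ h g : ℝ[X], IsMonicOfDegree h 1 ∧ IsMonicOfDegree g (2 * r) ∧ f = h * g := by
  intro r
  induction r with
  | zero => exact fun {f} hf => ⟨f, 1, hf, by simp, by simp⟩
  | succ r ih =>
    intro f hf
    rw [show 2 * (r + 1) + 1 = 2 * r + 1 + 2 by ring] at hf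
    obtain ⟨f₁, f₂, h1, h2, rfl⟩ := hf.eq_isMonicOfDegree_two_mul_isMonicOfDegree
    obtain ⟨h, g, hh, hg, rfl⟩ := ih h2
    refine ⟨h, f₁ * g, hh, ?_, by ring⟩
    rw [mul_add, add_comm]
    exact h1.mul hg

/-- In odd degree a cubic block is needed: a quadratic factor vanishing at `s` is completed by a
linear factor of its cofactor, and `s` may be real or not. -/
theorem exists_cubic_factor_isRoot {s : ℂ} : ∀ (r : ℕ) {f : ℝ[X]},
    IsMonicOfDegree f (2 * r + 3) → aeval s f = 0 →
    ∃ h g : ℝ[X], IsMonicOfDegree h 3 ∧ IsMonicOfDegree g (2 * r) ∧ f = h * g ∧ aeval s h = 0 := by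
  intro r
  induction r with
  | zero => exact fun {f} hf hs => ⟨f, 1, hf, by simp, by simp, hs⟩
  | succ r ih =>
    intro f hf hs
    rw [show 2 * (r + 1) + 3 = 2 * r + 3 + 2 by ring] at hf
    obtain ⟨f₁, f₂, h1, h2, rfl⟩ := hf.eq_isMonicOfDegree_two_mul_isMonicOfDegree
    rw [map_mul, mul_eq_zero] at hs
    rcases hs with hs | hs
    · rw [show 2 * r + 3 = 2 * (r + 1) + 1 by ring] at h2
      obtain ⟨h, g, hh, hg, rfl⟩ := exists_linear_factor _ h2
      exact ⟨f₁ * h, g, h1.mul hh, hg, by ring, by simp [hs]⟩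
    · obtain ⟨h, g, hh, hg, rfl, hs'⟩ := ih h2 hs
      refine ⟨h, f₁ * g, hh, ?_, by ring, hs'⟩
      rw [mul_add, add_comm]
      exact h1.mul hg

/-- A root of a monic real polynomial splits off over `ℂ`, and the imaginary parts of all roots
sum to zero. -/
theorem exists_roots_cons {s : ℂ} {h : ℝ[X]} {k : ℕ} (hh : IsMonicOfDegree h (k + 1))
    (hs : aeval s h = 0) : ∃ t : Multiset ℂ, t.card = k ∧
      h.map (algebraMap ℝ ℂ) = (X - C s) * (t.map (X - C ·)).prod ∧ s.im + t.sum.im = 0 := by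
  set H := h.map (algebraMap ℝ ℂ) with hH
  have hm : H.Monic := hh.monic.map _
  have hsp : H.Splits := IsAlgClosed.splits H
  have hmem : s ∈ H.roots := by
    rw [mem_roots hm.ne_zero, IsRoot, hH, eval_map_algebraMap, hs]
  obtain ⟨t, ht⟩ := Multiset.exists_cons_of_mem hmem
  refine ⟨t, ?_, ?_, ?_⟩
  · have h1 := hsp.natDegree_eq_card_roots
    rw [ht, Multiset.card_cons, hH, natDegree_map, hh.natDegree_eq] at h1
    omega
  · rw [hsp.eq_prod_roots_of_monic hm, ht, Multiset.map_cons, Multiset.prod_cons]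
  · have h1 := hsp.nextCoeff_eq_neg_sum_roots_of_monic hm
    rw [ht, Multiset.sum_cons, hH, nextCoeff_map (algebraMap ℝ ℂ).injective] at h1
    have h2 := congrArg Complex.im h1
    simp only [Complex.coe_algebraMap, Complex.ofReal_im, Complex.neg_im, Complex.add_im] at h2
    linarith

/-- Appending `c` terms to the first `N` terms of a sequence. -/
theorem prod_range_append {R : Type*} [CommRing R] (u v : ℕ → R) (N c : ℕ) :
    ∏ i ∈ Finset.range (N + c), (X - C (if i < N then u i else v (i - N))) =
      (∏ i ∈ Finset.range N, (X - C (u i))) * ∏ i ∈ Finset.range c, (X - C (v i)) := by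
  rw [Finset.prod_range_add]
  congr 1
  · refine Finset.prod_congr rfl fun i hi => ?_
    rw [if_pos (Finset.mem_range.1 hi)]
  · refine Finset.prod_congr rfl fun i _ => ?_
    rw [if_neg (by omega), Nat.add_sub_cancel_left]

/-- Each real quadratic factor contributes two consecutive roots whose imaginary parts sum to zero,
be they conjugate or both real. -/
theorem exists_conj_pairs : ∀ (r : ℕ) {f : ℝ[X]}, IsMonicOfDegree f (2 * r) →
    ∃ u : ℕ → ℂ, ∏ i ∈ Finset.range (2 * r), (X - C (u i)) = f.map (algebraMap ℝ ℂ) ∧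
      ∀ k, Even k → k < 2 * r → (u k).im = -(u (k + 1)).im := by
  intro r
  induction r with
  | zero =>
    intro f hf
    rw [mul_zero, isMonicOfDegree_zero_iff] at hf
    exact ⟨0, by simp [hf], by simp⟩
  | succ r ih =>
    intro f hf
    obtain ⟨f₁, f₂, h1, h2, rfl⟩ := hf.eq_isMonicOfDegree_two_mul_isMonicOfDegree
    obtain ⟨u, hu, hu'⟩ := ih h2
    obtain ⟨a, ha⟩ : ∃ a : ℂ, aeval a f₁ = 0 :=
      IsAlgClosed.exists_aeval_eq_zero _ f₁ (by
        rw [degree_eq_natDegree h1.ne_zero, h1.natDegree_eq]; norm_num)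
    obtain ⟨t, ht, hprod, him⟩ := exists_roots_cons (k := 1) h1 ha
    obtain ⟨b, rfl⟩ := Multiset.card_eq_one.1 ht
    refine ⟨fun i => if i < 2 * r then u i else (fun j => if j = 0 then a else b) (i - 2 * r),
      ?_, ?_⟩
    · dsimp only
      rw [mul_add, mul_one, prod_range_append u (fun j => if j = 0 then a else b), hu,
        Polynomial.map_mul, hprod]
      simp [Finset.prod_range_succ]
      ring
    · intro k hk hlt
      obtain ⟨j, rfl⟩ := hk
      by_cases h : j + j < 2 * r
      · have h' : j + j + 1 < 2 * r := by omega
        simpa only [h, h', if_true] using hu' (j + j) ⟨j, rfl⟩ h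
      · have h' : ¬ j + j + 1 < 2 * r := by omega
        have e1 : j + j - 2 * r = 0 := by omega
        have e2 : j + j + 1 - 2 * r = 1 := by omega
        simp only [h, h', if_false, e1, e2, if_true, one_ne_zero]
        simp only [Multiset.sum_singleton] at him
        linarith

/-- The roots of a monic real polynomial can be enumerated with a given root in the last place and
with imaginary parts as in `yPart`. -/
theorem exists_enumeration {m : ℕ} (hm : 0 < m) {f : ℝ[X]} (hf : IsMonicOfDegree f m) {s : ℂ}
    (hs : aeval s f = 0) : ∃ u : ℕ → ℂ,
      ∏ i ∈ Finset.range m, (X - C (u i)) = f.map (algebraMap ℝ ℂ) ∧ u (m - 1) = s ∧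
      ∀ k, Even k → k + 1 < m → (u k).im =
        if k + 3 = m then -(u (k + 1)).im - (u (k + 2)).im else -(u (k + 1)).im := by
  -- A final block of `c` roots ending in `s` is preceded by `r` pairs. Since `c ≠ 1`, the
  -- exceptional relation at `k + 3 = m` never falls on a pair.
  have htail : ∀ (r c : ℕ) (h g : ℝ[X]) (v : ℕ → ℂ), IsMonicOfDegree g (2 * r) →
      ∏ i ∈ Finset.range c, (X - C (v i)) = h.map (algebraMap ℝ ℂ) → 0 < c → v (c - 1) = s →
      (∀ k, Even k → k + 1 < c → (v k).im =
        if k + 3 = c then -(v (k + 1)).im - (v (k + 2)).im else -(v (k + 1)).im) → c ≤ 3 → c ≠ 1 →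
      ∃ u : ℕ → ℂ,
      ∏ i ∈ Finset.range (2 * r + c), (X - C (u i)) = (h * g).map (algebraMap ℝ ℂ) ∧
      u (2 * r + c - 1) = s ∧ ∀ k, Even k → k + 1 < 2 * r + c → (u k).im =
        if k + 3 = 2 * r + c then -(u (k + 1)).im - (u (k + 2)).im else -(u (k + 1)).im := by
    intro r c h g v hg hv hc hlast him hc3 hc1
    obtain ⟨u, hu, hu'⟩ := exists_conj_pairs r hg
    refine ⟨fun i => if i < 2 * r then u i else v (i - 2 * r), ?_, ?_, ?_⟩
    · rw [prod_range_append, hu, hv, Polynomial.map_mul, mul_comm]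
    · dsimp only
      rw [if_neg (by omega), ← hlast]; congr 1; omega
    · intro k hk hlt
      dsimp only
      by_cases h : k < 2 * r
      · obtain ⟨j, rfl⟩ := hk
        rw [if_pos h, if_neg (show ¬ j + j + 3 = 2 * r + c by omega),
          if_pos (show j + j + 1 < 2 * r by omega)]
        exact hu' _ ⟨j, rfl⟩ h
      · have := him (k - 2 * r) (by obtain ⟨j, rfl⟩ := hk; exact ⟨j - r, by omega⟩) (by omega)
        rw [if_neg h, if_neg (show ¬ k + 1 < 2 * r by omega),
          if_neg (show ¬ k + 2 < 2 * r by omega), this]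
        have e1 : k - 2 * r + 1 = k + 1 - 2 * r := by omega
        have e2 : k - 2 * r + 2 = k + 2 - 2 * r := by omega
        rw [e1, e2]
        exact if_congr (by omega) rfl rfl
  obtain ⟨r, rfl | rfl⟩ := Nat.even_or_odd' m
  · obtain ⟨r, rfl⟩ : ∃ r', r = r' + 1 := ⟨r - 1, by omega⟩
    obtain ⟨h, g, hh, hg, rfl, hs'⟩ := exists_quadratic_factor_isRoot r hf hs
    obtain ⟨t, ht, hprod, him⟩ := exists_roots_cons (k := 1) hh hs'
    obtain ⟨b, rfl⟩ := Multiset.card_eq_one.1 ht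
    refine htail r 2 h g (fun i => if i = 0 then b else s) hg ?_ (by norm_num) (by simp) ?_
      (by norm_num) (by norm_num)
    · rw [hprod]
      simp [Finset.prod_range_succ]
      ring
    · intro k _ hk2
      obtain rfl : k = 0 := by omega
      simp at him ⊢
      linarith
  · rcases Nat.eq_zero_or_pos r with rfl | hr
    · obtain ⟨t, ht, hprod, him⟩ := exists_roots_cons (k := 0) hf hs
      obtain rfl := Multiset.card_eq_zero.1 ht
      exact ⟨fun _ => s, by simp [hprod], rfl, by intro k _ hk; omega⟩
    · obtain ⟨r, rfl⟩ : ∃ r', r = r' + 1 := ⟨r - 1, by omega⟩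
      rw [show 2 * (r + 1) + 1 = 2 * r + 3 by ring] at hf ⊢
      obtain ⟨h, g, hh, hg, rfl, hs'⟩ := exists_cubic_factor_isRoot r hf hs
      obtain ⟨t, ht, hprod, him⟩ := exists_roots_cons (k := 2) hh hs'
      obtain ⟨a, b, rfl⟩ := Multiset.card_eq_two.1 ht
      refine htail r 3 h g (fun i => if i = 0 then a else if i = 1 then b else s) hg ?_
        (by norm_num) (by simp) ?_ (by norm_num) (by norm_num)
      · rw [hprod]
        simp [Finset.prod_range_succ]
        ring
      · intro k hk hk2
        obtain rfl : k = 0 := by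
          obtain ⟨j, rfl⟩ := hk; omega
        simp at him ⊢
        linarith

end RealFactors

/-! ### The set `Z_o` as ordered factorisations of `p(q, ·)` -/

section Roots

open Polynomial

variable {n m : ℕ}

/-- Vieta's formula for the polynomial with roots `sPart z`. -/
theorem coeff_prod_X_sub_C_sPart (z : Var n m → ℝ) {k : ℕ} (hk : k ≤ m) :
    (∏ l, (X - C (sPart z l))).coeff (m - k) = (-1) ^ k * elemSymm k z := by
  have h := Multiset.prod_X_sub_C_coeff (Finset.univ.val.map (sPart z)) (k := m - k) (by simp)
  rw [Finset.esymm_map_val, Multiset.map_map, Multiset.card_map, Finset.card_val,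
    Finset.card_univ, Fintype.card_fin, Nat.sub_sub_self hk] at h
  exact h

theorem coeff_specialise (p : Polynomial (MvPolynomial (Fin n) ℝ)) (q : Fin n → ℝ) (k : ℕ) :
    (specialise p q).coeff k = ((MvPolynomial.eval q (p.coeff k) : ℝ) : ℂ) := by
  simp [specialise]

theorem isMonicOfDegree_specialise_real {p : Polynomial (MvPolynomial (Fin n) ℝ)} (hp : p.Monic)
    (hdeg : p.natDegree = m) (q : Fin n → ℝ) :
    IsMonicOfDegree (p.map (MvPolynomial.eval q)) m :=
  ⟨by rw [hp.natDegree_map, hdeg], hp.map _⟩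

theorem specialise_eq_map (p : Polynomial (MvPolynomial (Fin n) ℝ)) (q : Fin n → ℝ) :
    specialise p q = (p.map (MvPolynomial.eval q)).map (algebraMap ℝ ℂ) := by
  rw [specialise, Polynomial.map_map]

theorem isMonicOfDegree_specialise {p : Polynomial (MvPolynomial (Fin n) ℝ)} (hp : p.Monic)
    (hdeg : p.natDegree = m) (q : Fin n → ℝ) : IsMonicOfDegree (specialise p q) m :=
  ⟨by rw [specialise, hp.natDegree_map, hdeg], hp.map _⟩

/-- By Vieta the equations match all coefficients below the leading one, and both sides are monic of
degree `m`. -/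
theorem specialise_eq_prod_iff {p : Polynomial (MvPolynomial (Fin n) ℝ)} (hp : p.Monic)
    (hdeg : p.natDegree = m) (z : Var n m → ℝ) :
    specialise p (qPart z) = ∏ l, (X - C (sPart z l)) ↔ ∀ k ∈ Finset.Icc 1 m,
      ((MvPolynomial.eval (qPart z) (p.coeff (m - k)) : ℝ) : ℂ) = (-1) ^ k * elemSymm k z := by
  constructor
  · intro h k hk
    rw [← coeff_specialise, h, coeff_prod_X_sub_C_sPart z (Finset.mem_Icc.1 hk).2]
  · intro h
    have hmon : (∏ l, (X - C (sPart z l))).Monic := monic_prod_of_monic _ _ fun l _ =>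
      monic_X_sub_C _
    have hd : (∏ l, (X - C (sPart z l))).natDegree = m := by
      rw [natDegree_prod_of_monic _ _ fun l _ => monic_X_sub_C _]; simp
    have hsp := isMonicOfDegree_specialise hp hdeg (qPart z)
    ext j
    rcases lt_or_ge m j with hj | hj
    · rw [coeff_eq_zero_of_natDegree_lt (by rw [hsp.natDegree_eq]; exact hj),
        coeff_eq_zero_of_natDegree_lt (by rw [hd]; exact hj)]
    · rcases hj.eq_or_lt with hj' | hj'
      · rw [hj', ((isMonicOfDegree_iff _ _).1 hsp).2,
          ((isMonicOfDegree_iff _ _).1 ⟨hd, hmon⟩).2]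
      · have h1 := h (m - j) (Finset.mem_Icc.2 ⟨by omega, by omega⟩)
        rw [← coeff_specialise, ← coeff_prod_X_sub_C_sPart z (by omega),
          Nat.sub_sub_self hj] at h1
        exact h1

theorem mem_rootSet_iff (hm : 0 < m) {p : Polynomial (MvPolynomial (Fin n) ℝ)} (hp : p.Monic)
    (hdeg : p.natDegree = m) (z : Var n m → ℝ) :
    z ∈ rootSet hm p ↔ qPart z ∈ box n ∧
      (∀ k : Fin m, k ≠ lastIdx hm → xPart z k ≤ xPart z (lastIdx hm)) ∧
      specialise p (qPart z) = ∏ l, (X - C (sPart z l)) := by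
  rw [specialise_eq_prod_iff hp hdeg]; rfl

theorem re_sPart (z : Var n m → ℝ) (k : Fin m) : (sPart z k).re = xPart z k := by
  simp [sPart]

theorem im_sPart (z : Var n m → ℝ) (k : Fin m) : (sPart z k).im = yPart z k := by
  simp [sPart]

theorem xPart_last_eq_abscissa (hm : 0 < m) {p : Polynomial (MvPolynomial (Fin n) ℝ)}
    (hp : p.Monic) (hdeg : p.natDegree = m) {z : Var n m → ℝ} (hz : z ∈ rootSet hm p) :
    xPart z (lastIdx hm) = abscissa p (qPart z) := by
  obtain ⟨-, hmax, hprod⟩ := (mem_rootSet_iff hm hp hdeg z).1 hz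
  have hroot : ∀ s, (specialise p (qPart z)).IsRoot s ↔ ∃ l, s = sPart z l := by
    intro s
    rw [hprod, IsRoot, eval_prod, Finset.prod_eq_zero_iff]
    simp [sub_eq_zero]
  have hmem : (specialise p (qPart z)).IsRoot (sPart z (lastIdx hm)) := (hroot _).2 ⟨_, rfl⟩
  suffices h : IsGreatest (Complex.re '' {s : ℂ | (specialise p (qPart z)).IsRoot s})
      (xPart z (lastIdx hm)) from h.csSup_eq.symm
  refine ⟨⟨_, hmem, re_sPart _ _⟩, ?_⟩
  rintro _ ⟨s, hs, rfl⟩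
  obtain ⟨l, rfl⟩ := (hroot s).1 hs
  rw [re_sPart]
  by_cases h : l = lastIdx hm
  · rw [h]
  · exact hmax l h

/-- Every parameter in the box is the `q`-part of a point of `rootSet`. -/
theorem exists_mem_rootSet (hm : 0 < m) {p : Polynomial (MvPolynomial (Fin n) ℝ)}
    (hp : p.Monic) (hdeg : p.natDegree = m) {q : Fin n → ℝ} (hq : q ∈ box n) :
    ∃ z ∈ rootSet hm p, qPart z = q := by
  have hf := isMonicOfDegree_specialise_real hp hdeg q
  have hsp := isMonicOfDegree_specialise hp hdeg q
  obtain ⟨s₀, hs₀⟩ : ∃ s, s ∈ (specialise p q).roots.toFinset := by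
    obtain ⟨s, hs⟩ := IsAlgClosed.exists_root (specialise p q) (by
      rw [degree_eq_natDegree hsp.ne_zero, hsp.natDegree_eq]; exact_mod_cast hm.ne')
    exact ⟨s, by simpa [hsp.ne_zero] using hs⟩
  -- Placing a rightmost root last makes every constraint `x_k ≤ x_m` hold.
  obtain ⟨s, hs, hmax⟩ := Finset.exists_max_image _ Complex.re ⟨s₀, hs₀⟩
  have hs' : aeval s (p.map (MvPolynomial.eval q)) = 0 := by
    rw [← eval_map_algebraMap, ← specialise_eq_map]
    simpa [hsp.ne_zero] using hs
  obtain ⟨u, hu, hlast, him⟩ := exists_enumeration hm hf hs'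
  rw [← specialise_eq_map] at hu
  set z : Var n m → ℝ :=
    Sum.elim q (Sum.elim (fun k => (u k).re) (fun k => (u k.1).im)) with hz
  have hzq : qPart z = q := rfl
  have hzs : ∀ k : Fin m, sPart z k = u k := by
    intro k
    apply Complex.ext
    · rw [re_sPart]; rfl
    · rw [im_sPart, yPart]
      split_ifs with h h3
      · rfl
      · rw [him k (by simpa using not_or.1 h |>.1) (by have := k.isLt; omega), if_pos h3]; rfl
      · rw [him k (by simpa using not_or.1 h |>.1) (by have := k.isLt; omega), if_neg h3]; rfl
  have hprod : specialise p q = ∏ l : Fin m, (X - C (sPart z l)) := by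
    rw [← hu, Finset.prod_range]
    simp only [hzs]
  refine ⟨z, (mem_rootSet_iff hm hp hdeg z).2 ⟨hq, fun k _ => ?_, hprod⟩, hzq⟩
  rw [← re_sPart, ← re_sPart, hzs, hzs]
  change _ ≤ (u (m - 1)).re
  rw [hlast]
  refine hmax _ ?_
  rw [Multiset.mem_toFinset, mem_roots hsp.ne_zero, IsRoot, hprod, eval_prod,
    Finset.prod_eq_zero (Finset.mem_univ k)]
  simp [hzs]

end Roots

/-! ### Bounding an element from a polynomial inequality on its powers -/

namespace IsQuadModule

variable {A : Type*} [CommRing A] [Algebra ℝ A] {M : Set A}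

/-- The Cauchy–Schwarz inequality in a quadratic module. -/
theorem card_smul_sum_sq_sub_sq_sum_mem (hM : IsQuadModule M) {ι : Type*} (s : Finset ι)
    (a : ι → A) : (s.card : ℝ) • ∑ i ∈ s, a i ^ 2 - (∑ i ∈ s, a i) ^ 2 ∈ M := by
  classical
  induction s using Finset.induction_on with
  | empty => simpa using hM.zero_mem
  | insert j s hj ih =>
    -- Adding the index `j` increases the expression by exactly `∑ (a i - a j)²`.
    convert hM.add_mem ih (hM.sum_mem s fun i _ => hM.sq_mem (a i - a j)) using 1
    have h1 : ∑ i ∈ s, (a i - a j) ^ 2 =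
        ∑ i ∈ s, a i ^ 2 - 2 * a j * ∑ i ∈ s, a i + (s.card : A) * a j ^ 2 := by
      simp only [sub_sq, Finset.sum_add_distrib, Finset.sum_sub_distrib, Finset.sum_const,
        nsmul_eq_mul, Finset.mul_sum]
      congr 2
      exact Finset.sum_congr rfl fun i _ => by ring
    rw [h1, Finset.sum_insert hj, Finset.sum_insert hj, Finset.card_insert_of_notMem hj]
    simp only [Algebra.smul_def, map_natCast]
    push_cast
    ring

variable {T : A}

/-- A lower power is at most an arbitrarily small multiple of the next one plus a constant. The
induction adds `T ^ j * (δT - 1)²`, which raises both exponents by one after division by `δ`. -/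
theorem smul_pow_succ_sub_pow_mem (hM : IsQuadModule M) (hT : IsSumSq T) (j : ℕ) :
    ∀ δ : ℝ, 0 < δ → ∃ N : ℝ, δ • T ^ (j + 1) - T ^ j + algebraMap ℝ A N ∈ M := by
  induction j with
  | zero =>
    intro δ hδ
    exact ⟨1, by simpa using hM.smul_mem hδ.le (hM.sumSq_mem hT)⟩
  | succ j ih =>
    intro δ hδ
    obtain ⟨N, hN⟩ := ih δ hδ
    refine ⟨N / δ, ?_⟩
    have h1 := hM.smul_mem (r := 1 / δ) (by positivity) (hM.add_mem hN
      (hM.sumSq_mul_mem (isSumSq_pow hT j) (hM.sq_mem (δ • T - 1))))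
    convert h1 using 1
    have h2 : δ • T ^ (j + 1) - T ^ j + algebraMap ℝ A N + T ^ j * (δ • T - 1) ^ 2 =
        δ • (δ • T ^ (j + 1 + 1) - T ^ (j + 1) + algebraMap ℝ A (N / δ)) := by
      have h3 : algebraMap ℝ A N = algebraMap ℝ A δ * algebraMap ℝ A (N / δ) := by
        rw [← map_mul, mul_div_cancel₀ _ hδ.ne']
      simp only [Algebra.smul_def, h3]
      ring
    rw [h2, smul_smul, one_div, inv_mul_cancel₀ hδ.ne', one_smul]

theorem smul_pow_sub_pow_mem (hM : IsQuadModule M) (hT : IsSumSq T) {k m : ℕ} (hkm : k < m) :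
    ∀ δ : ℝ, 0 < δ → ∃ N : ℝ, δ • T ^ m - T ^ k + algebraMap ℝ A N ∈ M := by
  induction m, hkm using Nat.le_induction with
  | base => exact hM.smul_pow_succ_sub_pow_mem hT k
  | succ m _ ih =>
    intro δ hδ
    obtain ⟨N, hN⟩ := ih 1 one_pos
    obtain ⟨K, hK⟩ := hM.smul_pow_succ_sub_pow_mem hT m δ hδ
    refine ⟨N + K, ?_⟩
    convert hM.add_mem hN hK using 1
    rw [map_add, one_smul]; ring

theorem smul_pow_sub_sum_mem (hM : IsQuadModule M) (hT : IsSumSq T) {m : ℕ} {c : ℕ → ℝ}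
    (hc : ∀ i, 0 < c i) (s : Finset ℕ) : (∀ i ∈ s, i < m) →
    ∀ δ : ℝ, 0 < δ → ∃ N : ℝ, δ • T ^ m - ∑ i ∈ s, c i • T ^ i + algebraMap ℝ A N ∈ M := by
  induction s using Finset.induction_on with
  | empty =>
    intro _ δ hδ
    obtain ⟨N, hN⟩ : ∃ N : ℝ, δ • T ^ m + algebraMap ℝ A N ∈ M := by
      refine ⟨0, ?_⟩
      rw [map_zero, add_zero]
      exact hM.smul_mem hδ.le (hM.sumSq_mem (isSumSq_pow hT m))
    exact ⟨N, by simpa using hN⟩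
  | insert j s hj ih =>
    intro hs δ hδ
    obtain ⟨N, hN⟩ := ih (fun i hi => hs i (by simp [hi])) (δ / 2) (half_pos hδ)
    obtain ⟨K, hK⟩ := hM.smul_pow_sub_pow_mem hT (hs j (by simp)) (δ / 2 / c j)
      (div_pos (half_pos hδ) (hc j))
    refine ⟨N + c j * K, ?_⟩
    convert hM.add_mem hN (hM.smul_mem (hc j).le hK) using 1
    have h1 : c j • (δ / 2 / c j) • T ^ m = (δ / 2) • T ^ m := by
      rw [smul_smul, mul_div_cancel₀ _ (hc j).ne']
    have h2 : δ • T ^ m = (δ / 2) • T ^ m + (δ / 2) • T ^ m := by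
      rw [← add_smul, add_halves]
    rw [Finset.sum_insert hj, smul_add, smul_sub, h1, h2, map_add, map_mul, Algebra.smul_def (c j)
      (algebraMap ℝ A K)]
    ring

/-- A sum of squares `T` with `T ^ m ≤ ∑ i < m, c i * T ^ i` is bounded. -/
theorem exists_sub_mem_of_pow_le (hM : IsQuadModule M) (hT : IsSumSq T) {m : ℕ} (hm : 0 < m)
    {c : ℕ → ℝ} (hc : ∀ i, 0 < c i)
    (h : ∑ i ∈ Finset.range m, c i • T ^ i - T ^ m ∈ M) :
    ∃ N : ℝ, algebraMap ℝ A N - T ∈ M := by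
  -- The lower-order terms are absorbed into half of `T ^ m`, leaving `T ^ m ≤ 2N`.
  obtain ⟨N, hN⟩ := hM.smul_pow_sub_sum_mem hT hc (Finset.range m)
    (fun i hi => Finset.mem_range.1 hi) (1 / 2) (by norm_num)
  have h1 : algebraMap ℝ A (2 * N) - T ^ m ∈ M := by
    convert hM.smul_mem (zero_le_two) (hM.add_mem h hN) using 1
    have : T ^ m = (1 / 2 : ℝ) • T ^ m + (1 / 2 : ℝ) • T ^ m := by
      rw [← add_smul, add_halves, one_smul]
    rw [ofNat_smul_eq_nsmul, nsmul_eq_mul, map_mul, map_ofNat]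
    push_cast
    linear_combination this
  obtain rfl | h2 : m = 1 ∨ 1 < m := by omega
  · exact ⟨2 * N, by simpa using h1⟩
  · obtain ⟨K, hK⟩ := hM.smul_pow_sub_pow_mem hT h2 1 one_pos
    refine ⟨2 * N + K, ?_⟩
    convert hM.add_mem h1 hK using 1
    rw [one_smul, map_add, pow_one]; ring

end IsQuadModule

/-! ### The quadratic module of the semidefinite program -/

section Certificates

variable {n m : ℕ}

/-- The right-hand side of the identity in the semidefinite program. -/
noncomputable def certificate (hm : 0 < m) (p : Polynomial (MvPolynomial (Fin n) ℝ))
    (σ₀ : MvPolynomial (Var n m) ℝ) (σ : Fin n → MvPolynomial (Var n m) ℝ)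
    (σx : Fin m → MvPolynomial (Var n m) ℝ) (τRe τIm : ℕ → MvPolynomial (Var n m) ℝ)
    (z : Var n m → ℝ) : ℝ :=
  MvPolynomial.eval z σ₀
    + ∑ j : Fin n, MvPolynomial.eval z (σ j) * (1 - qPart z j ^ 2)
    + ∑ k ∈ Finset.univ.erase (lastIdx hm),
        MvPolynomial.eval z (σx k) * (xPart z (lastIdx hm) - xPart z k)
    + ∑ k ∈ Finset.Icc 1 m, MvPolynomial.eval z (τRe k) *
        ((-1) ^ k * MvPolynomial.eval (qPart z) (p.coeff (m - k)) - (elemSymm k z).re)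
    + ∑ k ∈ Finset.Icc 1 m, MvPolynomial.eval z (τIm k) * (elemSymm k z).im

/-- The quadratic module of the semidefinite program, without degree bounds. -/
def certModule (hm : 0 < m) (p : Polynomial (MvPolynomial (Fin n) ℝ)) :
    Set (MvPolynomial (Var n m) ℝ) :=
  {f | ∃ σ₀ σ σx τRe τIm, IsSumSq σ₀ ∧ (∀ j, IsSumSq (σ j)) ∧ (∀ k, IsSumSq (σx k)) ∧
    ∀ z, MvPolynomial.eval z f = certificate hm p σ₀ σ σx τRe τIm z}

theorem isQuadModule_certModule (hm : 0 < m) (p : Polynomial (MvPolynomial (Fin n) ℝ)) :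
    IsQuadModule (certModule hm p) where
  one_mem := ⟨1, 0, 0, 0, 0, IsSumSq.one, fun _ => .zero, fun _ => .zero, fun z => by
    simp [certificate]⟩
  add_mem := by
    rintro f g ⟨a₀, a, ax, aR, aI, h0, h, hx, hf⟩ ⟨b₀, b, bx, bR, bI, h0', h', hx', hg⟩
    refine ⟨a₀ + b₀, a + b, ax + bx, aR + bR, aI + bI, h0.add h0', fun j => (h j).add (h' j),
      fun k => (hx k).add (hx' k), fun z => ?_⟩
    rw [map_add, hf, hg]
    simp only [certificate, Pi.add_apply, map_add, add_mul, Finset.sum_add_distrib]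
    ring
  sq_mul_mem := by
    rintro c f ⟨a₀, a, ax, aR, aI, h0, h, hx, hf⟩
    have hc : IsSumSq (c ^ 2) := (IsSquare.sq c).isSumSq
    refine ⟨c ^ 2 * a₀, fun j => c ^ 2 * a j, fun j => c ^ 2 * ax j, fun j => c ^ 2 * aR j,
      fun j => c ^ 2 * aI j, hc.mul h0, fun j => hc.mul (h j),
      fun k => hc.mul (hx k), fun z => ?_⟩
    rw [map_mul, hf]
    simp only [certificate, map_mul, mul_assoc, ← Finset.mul_sum]
    ring

theorem one_sub_sq_mem_certModule (hm : 0 < m) (p : Polynomial (MvPolynomial (Fin n) ℝ))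
    (j : Fin n) : 1 - MvPolynomial.X (Sum.inl j) ^ 2 ∈ certModule hm p := by
  refine ⟨0, Pi.single j 1, 0, 0, 0, .zero, fun i => ?_, fun _ => .zero, fun z => ?_⟩
  · by_cases h : i = j
    · subst h; simp
    · simp [Pi.single_eq_of_ne h]
  · have : ∀ i, MvPolynomial.eval z (Pi.single (M := fun _ => MvPolynomial (Var n m) ℝ) j 1 i) =
        if i = j then 1 else 0 := fun i => by
      by_cases h : i = j
      · subst h; simp
      · simp [h]
    simp [certificate, this, qPart]

theorem sub_mem_certModule (hm : 0 < m) (p : Polynomial (MvPolynomial (Fin n) ℝ))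
    {k : Fin m} (hk : k ≠ lastIdx hm) :
    MvPolynomial.X (Sum.inr (Sum.inl (lastIdx hm))) - MvPolynomial.X (Sum.inr (Sum.inl k)) ∈
      certModule hm p := by
  refine ⟨0, 0, Pi.single k 1, 0, 0, .zero, fun _ => .zero, fun i => ?_, fun z => ?_⟩
  · by_cases h : i = k
    · subst h; simp
    · simp [Pi.single_eq_of_ne h]
  · have : ∀ i, MvPolynomial.eval z (Pi.single (M := fun _ => MvPolynomial (Var n m) ℝ) k 1 i) =
        if i = k then 1 else 0 := fun i => by
      by_cases h : i = k
      · subst h; simp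
      · simp [h]
    simp [certificate, this, xPart, hk]

theorem mem_certModule_of_re (hm : 0 < m) (p : Polynomial (MvPolynomial (Fin n) ℝ)) {k : ℕ}
    (hk : k ∈ Finset.Icc 1 m) (c : ℝ) {f : MvPolynomial (Var n m) ℝ}
    (hf : ∀ z, MvPolynomial.eval z f = c *
      ((-1) ^ k * MvPolynomial.eval (qPart z) (p.coeff (m - k)) - (elemSymm k z).re)) :
    f ∈ certModule hm p := by
  refine ⟨0, 0, 0, fun i => if i = k then MvPolynomial.C c else 0, 0, .zero, fun _ => .zero,
    fun _ => .zero, fun z => ?_⟩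
  have : ∀ i, MvPolynomial.eval z (if i = k then MvPolynomial.C c else 0) *
      ((-1) ^ i * MvPolynomial.eval (qPart z) (p.coeff (m - i)) - (elemSymm i z).re) =
      if i = k then c *
        ((-1) ^ k * MvPolynomial.eval (qPart z) (p.coeff (m - k)) - (elemSymm k z).re) else 0 :=
    fun i => by split_ifs with h <;> simp [h]
  rw [hf, certificate]
  simp only [this, Finset.sum_ite_eq', if_pos hk]
  simp

theorem mem_certModule_of_im (hm : 0 < m) (p : Polynomial (MvPolynomial (Fin n) ℝ)) {k : ℕ}
    (hk : k ∈ Finset.Icc 1 m) (c : ℝ) {f : MvPolynomial (Var n m) ℝ}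
    (hf : ∀ z, MvPolynomial.eval z f = c * (elemSymm k z).im) :
    f ∈ certModule hm p := by
  refine ⟨0, 0, 0, 0, fun i => if i = k then MvPolynomial.C c else 0, .zero, fun _ => .zero,
    fun _ => .zero, fun z => ?_⟩
  have : ∀ i, MvPolynomial.eval z (if i = k then MvPolynomial.C c else 0) *
      (elemSymm i z).im = if i = k then c * (elemSymm k z).im else 0 := fun i => by
    split_ifs with h <;> simp [h]
  rw [hf, certificate]
  simp only [this, Finset.sum_ite_eq', if_pos hk]
  simp

end Certificates

/-! ### The Archimedean property of the module -/

section Archimedean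

open ComplexConjugate

variable {n m : ℕ}

/-- The real and imaginary part of `F` are polynomials from the ideal `I`. -/
def IsPolyFn {ι : Type*} (I : Ideal (MvPolynomial ι ℝ)) (F : (ι → ℝ) → ℂ) : Prop :=
  ∃ u ∈ I, ∃ v ∈ I, ∀ z, (F z).re = MvPolynomial.eval z u ∧ (F z).im = MvPolynomial.eval z v

namespace IsPolyFn

variable {ι : Type*} {F G : (ι → ℝ) → ℂ}

theorem add {I : Ideal (MvPolynomial ι ℝ)} (hF : IsPolyFn I F) (hG : IsPolyFn I G) :
    IsPolyFn I (fun z => F z + G z) := by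
  obtain ⟨u, hu, v, hv, h⟩ := hF
  obtain ⟨u', hu', v', hv', h'⟩ := hG
  exact ⟨u + u', I.add_mem hu hu', v + v', I.add_mem hv hv', fun z => by simp [h, h']⟩

theorem zero (I : Ideal (MvPolynomial ι ℝ)) : IsPolyFn I (fun _ => 0) :=
  ⟨0, I.zero_mem, 0, I.zero_mem, by simp⟩

theorem sum {I : Ideal (MvPolynomial ι ℝ)} {κ : Type*} (s : Finset κ) {F : κ → (ι → ℝ) → ℂ}
    (hF : ∀ i ∈ s, IsPolyFn I (F i)) : IsPolyFn I (fun z => ∑ i ∈ s, F i z) := by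
  classical
  induction s using Finset.induction_on with
  | empty => simpa using zero I
  | insert i s hi ih =>
    simp only [Finset.sum_insert hi]
    exact (hF i (by simp)).add (ih fun j hj => hF j (by simp [hj]))

theorem mul {I : Ideal (MvPolynomial ι ℝ)} (hF : IsPolyFn I F) (hG : IsPolyFn ⊤ G) :
    IsPolyFn I (fun z => F z * G z) := by
  obtain ⟨u, hu, v, hv, h⟩ := hF
  obtain ⟨u', -, v', -, h'⟩ := hG
  exact ⟨u * u' - v * v', I.sub_mem (I.mul_mem_right _ hu) (I.mul_mem_right _ hv),
    u * v' + v * u', I.add_mem (I.mul_mem_right _ hu) (I.mul_mem_right _ hv),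
    fun z => by simp [h, h']⟩

theorem conjugate {I : Ideal (MvPolynomial ι ℝ)} (hF : IsPolyFn I F) :
    IsPolyFn I (fun z => conj (F z)) := by
  obtain ⟨u, hu, v, hv, h⟩ := hF
  exact ⟨u, hu, -v, I.neg_mem hv, fun z => by simp [h]⟩

theorem to_top {I : Ideal (MvPolynomial ι ℝ)} (hF : IsPolyFn I F) : IsPolyFn ⊤ F := by
  obtain ⟨u, hu, v, hv, h⟩ := hF
  exact ⟨u, trivial, v, trivial, h⟩

theorem ofReal (f : MvPolynomial ι ℝ) :
    IsPolyFn ⊤ (fun z => ((MvPolynomial.eval z f : ℝ) : ℂ)) :=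
  ⟨f, trivial, 0, trivial, by simp⟩

theorem prod {κ : Type*} (s : Finset κ) {F : κ → (ι → ℝ) → ℂ}
    (hF : ∀ i ∈ s, IsPolyFn ⊤ (F i)) : IsPolyFn ⊤ (fun z => ∏ i ∈ s, F i z) := by
  classical
  induction s using Finset.induction_on with
  | empty => simpa using ofReal (ι := ι) 1
  | insert i s hi ih =>
    simp only [Finset.prod_insert hi]
    exact (((hF i (by simp))).mul
      (ih fun j hj => hF j (by simp [hj])))

theorem pow (hF : IsPolyFn ⊤ F) (k : ℕ) : IsPolyFn ⊤ (fun z => F z ^ k) := by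
  simpa using prod (Finset.range k) fun _ _ => hF

end IsPolyFn

/-- The support `M ∩ -M` of the quadratic module, as an ideal. -/
def certSupport (hm : 0 < m) (p : Polynomial (MvPolynomial (Fin n) ℝ)) :
    Ideal (MvPolynomial (Var n m) ℝ) where
  carrier := {f | f ∈ certModule hm p ∧ -f ∈ certModule hm p}
  add_mem' := by
    rintro f g ⟨hf, hf'⟩ ⟨hg, hg'⟩
    have hM := isQuadModule_certModule hm p
    exact ⟨hM.add_mem hf hg, by rw [neg_add]; exact hM.add_mem hf' hg'⟩
  zero_mem' := by
    have hM := isQuadModule_certModule hm p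
    exact ⟨hM.zero_mem, by simpa using hM.zero_mem⟩
  smul_mem' := by
    rintro c f ⟨hf, hf'⟩
    have hM := isQuadModule_certModule hm p
    exact ⟨hM.support_mul_mem hf hf' c, by
      simpa using hM.support_mul_mem hf' (by simpa using hf) c⟩

theorem exists_yPart_poly (k : Fin m) :
    ∃ f : MvPolynomial (Var n m) ℝ, ∀ z, MvPolynomial.eval z f = yPart z k := by
  by_cases h : Odd (k : ℕ) ∨ (k : ℕ) + 1 = m
  · exact ⟨MvPolynomial.X (Sum.inr (Sum.inr ⟨k, h⟩)), fun z => by simp [yPart, h]⟩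
  · have hk : (k : ℕ) + 1 < m := by have := k.isLt; omega
    have ho : Odd ((k : ℕ) + 1) := by
      rw [not_or, Nat.not_odd_iff_even] at h
      exact h.1.add_one
    by_cases h3 : (k : ℕ) + 3 = m
    · exact ⟨- MvPolynomial.X (Sum.inr (Sum.inr ⟨⟨(k : ℕ) + 1, hk⟩, Or.inl ho⟩))
        - MvPolynomial.X (Sum.inr (Sum.inr ⟨⟨(k : ℕ) + 2, by omega⟩, Or.inr h3⟩)),
        fun z => by simp only [yPart, h, h3, dif_pos, dif_neg, map_sub, map_neg,
          MvPolynomial.eval_X, not_false_eq_true]⟩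
    · exact ⟨- MvPolynomial.X (Sum.inr (Sum.inr ⟨⟨(k : ℕ) + 1, hk⟩, Or.inl ho⟩)),
        fun z => by simp only [yPart, h, h3, dif_neg, map_neg, MvPolynomial.eval_X,
          not_false_eq_true]⟩

theorem isPolyFn_sPart (k : Fin m) : IsPolyFn ⊤ (fun z : Var n m → ℝ => sPart z k) := by
  obtain ⟨f, hf⟩ := exists_yPart_poly (n := n) k
  exact ⟨MvPolynomial.X (Sum.inr (Sum.inl k)), trivial, f, trivial, fun z =>
    ⟨by simp [re_sPart, xPart], by rw [im_sPart, hf]⟩⟩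

theorem isPolyFn_elemSymm (k : ℕ) :
    IsPolyFn ⊤ (fun z : Var n m → ℝ => elemSymm k z) := by
  exact IsPolyFn.sum _ fun t _ =>
    (IsPolyFn.prod t fun l _ => isPolyFn_sPart l)

theorem eval_rename_inl (f : MvPolynomial (Fin n) ℝ) (z : Var n m → ℝ) :
    MvPolynomial.eval z (MvPolynomial.rename Sum.inl f) = MvPolynomial.eval (qPart z) f := by
  rw [MvPolynomial.eval_rename]; rfl

/-- The multipliers `τ` carry no sign condition, so the real and imaginary parts of each equation
lie in the module with both signs. -/
theorem isPolyFn_equation (hm : 0 < m) (p : Polynomial (MvPolynomial (Fin n) ℝ)) {k : ℕ}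
    (hk : k ∈ Finset.Icc 1 m) : IsPolyFn (certSupport hm p)
      (fun z => (-1) ^ k * ((MvPolynomial.eval (qPart z) (p.coeff (m - k)) : ℝ) : ℂ) -
        elemSymm k z) := by
  obtain ⟨u, -, v, -, h⟩ := isPolyFn_elemSymm (n := n) (m := m) k
  set f : MvPolynomial (Var n m) ℝ :=
    (-1) ^ k * MvPolynomial.rename Sum.inl (p.coeff (m - k)) - u with hf
  have hre : ∀ z, MvPolynomial.eval z f =
      (-1) ^ k * MvPolynomial.eval (qPart z) (p.coeff (m - k)) - (elemSymm k z).re := fun z => by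
    simp [hf, eval_rename_inl, (h z).1]
  have hpow : ((-1 : ℂ)) ^ k = (((-1 : ℝ) ^ k : ℝ) : ℂ) := by push_cast; rfl
  refine ⟨f, ⟨mem_certModule_of_re hm p hk 1 fun z => by rw [hre, one_mul],
      mem_certModule_of_re hm p hk (-1) fun z => by rw [map_neg, hre]; ring⟩, -v,
    ⟨mem_certModule_of_im hm p hk (-1) fun z => by rw [map_neg, ← (h z).2]; ring,
      mem_certModule_of_im hm p hk 1 fun z => by rw [neg_neg, ← (h z).2, one_mul]⟩,
    fun z => ⟨?_, ?_⟩⟩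
  · dsimp only
    rw [hre, hpow, ← Complex.ofReal_mul, Complex.sub_re, Complex.ofReal_re]
  · dsimp only
    rw [map_neg, ← (h z).2, hpow, ← Complex.ofReal_mul, Complex.sub_im, Complex.ofReal_im, zero_sub]

/-- Each `sPart z l` is a root of `p(qPart z, ·)` modulo the support. -/
theorem isPolyFn_aeval_sPart (hm : 0 < m) (p : Polynomial (MvPolynomial (Fin n) ℝ)) (l : Fin m) :
    IsPolyFn (certSupport hm p) (fun z =>
      sPart z l ^ m + ∑ i ∈ Finset.range m,
        ((MvPolynomial.eval (qPart z) (p.coeff i) : ℝ) : ℂ) * sPart z l ^ i) := by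
  -- The equations weighted by `(-1) ^ (m - i) * s_l ^ i` add up to `p(q, s_l) - ∏ (s_l - s_j)`,
  -- whose product vanishes.
  have h1 : IsPolyFn (certSupport hm p) (fun z =>
      ∑ i ∈ Finset.range m, ((-1) ^ (m - i) * ((MvPolynomial.eval (qPart z)
        (p.coeff (m - (m - i))) : ℝ) : ℂ) - elemSymm (m - i) z) *
        ((-1) ^ (m - i) * sPart z l ^ i)) := by
    refine IsPolyFn.sum _ fun i hi => (isPolyFn_equation hm p ?_).mul ?_
    · have := Finset.mem_range.1 hi
      exact Finset.mem_Icc.2 ⟨by omega, by omega⟩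
    · have h2 := IsPolyFn.ofReal (ι := Var n m) (MvPolynomial.C ((-1) ^ (m - i)))
      have h3 := (h2).mul ((isPolyFn_sPart (n := n) l).pow i)
      simpa using h3.to_top
  convert h1 using 2 with z
  have h2 : (∏ j, (Polynomial.X - Polynomial.C (sPart z j))).eval (sPart z l) = 0 := by
    rw [Polynomial.eval_prod]
    exact Finset.prod_eq_zero (Finset.mem_univ l) (by simp)
  have hd : (∏ j, (Polynomial.X - Polynomial.C (sPart z j))).natDegree = m := by
    rw [Polynomial.natDegree_prod_of_monic _ _ fun l _ => Polynomial.monic_X_sub_C _]; simp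
  rw [Polynomial.eval_eq_sum_range, hd, Finset.sum_range_succ] at h2
  have h3 := coeff_prod_X_sub_C_sPart z (k := 0) (Nat.zero_le m)
  have h4 : elemSymm 0 z = 1 := by simp [elemSymm]
  rw [Nat.sub_zero, h4, pow_zero, one_mul] at h3
  rw [h3, one_mul] at h2
  have h5 : ∀ i ∈ Finset.range m,
      (∏ j, (Polynomial.X - Polynomial.C (sPart z j))).coeff i * sPart z l ^ i =
      (-1) ^ (m - i) * elemSymm (m - i) z * sPart z l ^ i := fun i hi => by
    have := Finset.mem_range.1 hi
    have h6 := coeff_prod_X_sub_C_sPart z (k := m - i) (by omega)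
    rw [Nat.sub_sub_self this.le] at h6
    rw [h6]
  rw [Finset.sum_congr rfl h5] at h2
  have h7 : sPart z l ^ m =
      -∑ i ∈ Finset.range m, (-1) ^ (m - i) * elemSymm (m - i) z * sPart z l ^ i := by
    linear_combination h2
  rw [h7, neg_add_eq_sub, ← Finset.sum_sub_distrib]
  refine Finset.sum_congr rfl fun i hi => ?_
  have := Finset.mem_range.1 hi
  rw [Nat.sub_sub_self this.le]
  have h8 : ((-1 : ℂ) ^ (m - i)) * (-1) ^ (m - i) = 1 := by
    rw [← mul_pow]; simp
  linear_combination (-(((MvPolynomial.eval (qPart z) (p.coeff i) : ℝ) : ℂ) * sPart z l ^ i)) * h8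

theorem algHom_mem_of_forall_X_mem {σ A : Type*} [CommRing A] [Algebra ℝ A]
    (φ : MvPolynomial σ ℝ →ₐ[ℝ] A) {S : Subalgebra ℝ A} (hφ : ∀ i, φ (MvPolynomial.X i) ∈ S)
    (f : MvPolynomial σ ℝ) : φ f ∈ S := by
  induction f using MvPolynomial.induction_on with
  | C a => exact (φ.commutes a).symm ▸ S.algebraMap_mem a
  | add f g hf hg => rw [map_add]; exact S.add_mem hf hg
  | mul_X f i hf => rw [map_mul]; exact S.mul_mem hf (hφ i)

theorem rename_inl_mem_bounded (hm : 0 < m) (p : Polynomial (MvPolynomial (Fin n) ℝ))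
    (f : MvPolynomial (Fin n) ℝ) :
    MvPolynomial.rename Sum.inl f ∈ (isQuadModule_certModule hm p).bounded := by
  refine algHom_mem_of_forall_X_mem (MvPolynomial.rename Sum.inl) (fun j => ?_) f
  rw [MvPolynomial.rename_X, IsQuadModule.mem_bounded]
  exact ⟨1, zero_le_one, by simpa using one_sub_sq_mem_certModule hm p j⟩

/-- The root bound for `T = |s_l|²`: modulo the support `s_l ^ m = -∑ p_i s_l ^ i`, hence by
Cauchy–Schwarz `T ^ m ≤ m ∑ p_i² T ^ i`, where `p_i² ≤ c_i` in the module. -/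
theorem exists_sub_norm_sq_mem (hm : 0 < m) (p : Polynomial (MvPolynomial (Fin n) ℝ)) (l : Fin m)
    {y : MvPolynomial (Var n m) ℝ} (hy : ∀ z, MvPolynomial.eval z y = yPart z l) :
    ∃ N : ℝ, algebraMap ℝ _ N - (MvPolynomial.X (Sum.inr (Sum.inl l)) ^ 2 + y ^ 2) ∈
      certModule hm p := by
  have hM := isQuadModule_certModule hm p
  set T : MvPolynomial (Var n m) ℝ := MvPolynomial.X (Sum.inr (Sum.inl l)) ^ 2 + y ^ 2 with hT
  have hTsq : IsSumSq T := (IsSquare.sq _).isSumSq.add (IsSquare.sq _).isSumSq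
  have hTpow : ∀ i : ℕ, IsSumSq (T ^ i) := isSumSq_pow hTsq
  have hTz : ∀ z, MvPolynomial.eval z T = Complex.normSq (sPart z l) := fun z => by
    rw [Complex.normSq_apply, re_sPart, im_sPart, hT, map_add, map_pow, map_pow, hy]
    simp [xPart]; ring
  let P : ℕ → MvPolynomial (Var n m) ℝ := fun i => MvPolynomial.rename Sum.inl (p.coeff i)
  have hP : ∀ i, P i ∈ hM.bounded := fun i => rename_inl_mem_bounded hm p _
  choose c hc0 hc using fun i => hM.mem_bounded.1 (hP i)
  have hterm : ∀ i, IsPolyFn ⊤ (fun z : Var n m → ℝ =>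
      ((MvPolynomial.eval (qPart z) (p.coeff i) : ℝ) : ℂ) * sPart z l ^ i) := fun i => by
    have h2 := IsPolyFn.ofReal (P i)
    have h3 := (h2).mul ((isPolyFn_sPart (n := n) l).pow i)
    simpa only [P, eval_rename_inl] using h3.to_top
  choose a _ b _ hab using hterm
  have hF := isPolyFn_aeval_sPart hm p l
  have hsum : IsPolyFn ⊤ (fun z : Var n m → ℝ => ∑ i ∈ Finset.range m,
      ((MvPolynomial.eval (qPart z) (p.coeff i) : ℝ) : ℂ) * sPart z l ^ i) :=
    ⟨∑ i ∈ Finset.range m, a i, trivial, ∑ i ∈ Finset.range m, b i, trivial, fun z => by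
      rw [Complex.re_sum, Complex.im_sum, map_sum, map_sum]
      exact ⟨Finset.sum_congr rfl fun i _ => (hab i z).1,
        Finset.sum_congr rfl fun i _ => (hab i z).2⟩⟩
  -- With `W = s_l ^ m` and `B = ∑ p_i s_l ^ i`, the real part of `(W + B) * conj (W - B)` is `|W|²
  -- - |B|²`; it is in the support because `W + B` is.
  obtain ⟨u, hu, v, _, hu'⟩ : IsPolyFn (certSupport hm p)
      (fun z => (sPart z l ^ m + ∑ i ∈ Finset.range m,
        ((MvPolynomial.eval (qPart z) (p.coeff i) : ℝ) : ℂ) * sPart z l ^ i) *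
      conj (sPart z l ^ m + -∑ i ∈ Finset.range m,
        ((MvPolynomial.eval (qPart z) (p.coeff i) : ℝ) : ℂ) * sPart z l ^ i)) := by
    refine hF.mul (IsPolyFn.conjugate ?_)
    have h1 := ((isPolyFn_sPart (n := n) l).pow m)
    have h2 := (hsum).mul (IsPolyFn.ofReal (MvPolynomial.C (-1)))
    simpa using h1.add h2
  have hTm : T ^ m = (∑ i ∈ Finset.range m, a i) ^ 2 + (∑ i ∈ Finset.range m, b i) ^ 2 + u := by
    refine MvPolynomial.funext fun z => ?_
    have h1 := (hu' z).1
    set B := ∑ i ∈ Finset.range m,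
      ((MvPolynomial.eval (qPart z) (p.coeff i) : ℝ) : ℂ) * sPart z l ^ i with hB
    have h2 : MvPolynomial.eval z (∑ i ∈ Finset.range m, a i) = B.re := by
      rw [hB, Complex.re_sum, map_sum]
      exact Finset.sum_congr rfl fun i _ => (hab i z).1.symm
    have h3 : MvPolynomial.eval z (∑ i ∈ Finset.range m, b i) = B.im := by
      rw [hB, Complex.im_sum, map_sum]
      exact Finset.sum_congr rfl fun i _ => (hab i z).2.symm
    have key : ∀ W B : ℂ, W.re * W.re + W.im * W.im =
        B.re ^ 2 + B.im ^ 2 + ((W + B) * conj (W + -B)).re := fun W B => by simp; ring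
    rw [map_add, map_add, map_pow, map_pow, map_pow, h2, h3, ← h1, hTz,
      ← map_pow Complex.normSq, Complex.normSq_apply]
    exact key _ _
  have hPT : ∀ i, a i ^ 2 + b i ^ 2 = P i ^ 2 * T ^ i := fun i => by
    refine MvPolynomial.funext fun z => ?_
    rw [map_add, map_pow, map_pow, ← (hab i z).1, ← (hab i z).2, map_mul, map_pow, map_pow, hTz,
      show MvPolynomial.eval z (P i) = _ from eval_rename_inl _ z,
      ← map_pow Complex.normSq, Complex.re_ofReal_mul, Complex.im_ofReal_mul,
      Complex.normSq_apply]
    ring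
  refine hM.exists_sub_mem_of_pow_le hTsq hm (c := fun i => (m : ℝ) * c i + 1)
    -- The extra `1` makes the coefficients strictly positive; `k4` pays for it.
    (fun i => by have := hc0 i; positivity) ?_
  have k1 := hM.card_smul_sum_sq_sub_sq_sum_mem (Finset.range m) a
  have k2 := hM.card_smul_sum_sq_sub_sq_sum_mem (Finset.range m) b
  have k3 := hM.sum_mem (Finset.range m) fun i _ => hM.smul_mem (Nat.cast_nonneg m)
    (hM.sumSq_mul_mem (hTpow i) (hc i))
  have k4 := hM.sum_mem (Finset.range m) fun i _ => hM.sumSq_mem (hTpow i)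
  convert hM.add_mem (hM.add_mem (hM.add_mem (hM.add_mem k1 k2) k3) k4) hu.2 using 1
  have e1 : ∑ i ∈ Finset.range m, ((m : ℝ) * c i + 1) • T ^ i =
      ∑ i ∈ Finset.range m, (m : ℝ) • (T ^ i * (algebraMap ℝ _ (c i) - P i ^ 2)) +
      (m : ℝ) • ∑ i ∈ Finset.range m, (a i ^ 2 + b i ^ 2) + ∑ i ∈ Finset.range m, T ^ i := by
    rw [Finset.smul_sum, ← Finset.sum_add_distrib, ← Finset.sum_add_distrib]
    refine Finset.sum_congr rfl fun i _ => ?_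
    rw [hPT]
    simp only [Algebra.smul_def, map_add, map_mul, map_one]
    ring
  rw [e1, hTm, Finset.sum_add_distrib, smul_add, Finset.card_range]
  ring

/-- Bounded elements form a subalgebra, so only the coordinates need bounds; those on `x` and `y`
follow from the bound on `x² + y²`. -/
theorem archimedean_certModule (hm : 0 < m) (p : Polynomial (MvPolynomial (Fin n) ℝ))
    (f : MvPolynomial (Var n m) ℝ) : ∃ N : ℝ, algebraMap ℝ _ N - f ∈ certModule hm p := by
  have hM := isQuadModule_certModule hm p
  refine hM.exists_sub_mem_of_mem_bounded ?_
  have hnonneg : ∀ {g : MvPolynomial (Var n m) ℝ} {N : ℝ},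
      algebraMap ℝ _ N - g ^ 2 ∈ certModule hm p → g ∈ hM.bounded := fun {g N} h =>
    ⟨max N 0, le_max_right _ _, by
      convert hM.add_mem h (hM.const_mem (sub_nonneg.2 (le_max_left N 0))) using 1
      rw [map_sub]; ring⟩
  refine algHom_mem_of_forall_X_mem (AlgHom.id ℝ _) ?_ f
  rintro (j | k | k)
  · exact hnonneg (N := 1) (by simpa using one_sub_sq_mem_certModule hm p j)
  · obtain ⟨y, hy⟩ := exists_yPart_poly (n := n) k
    obtain ⟨N, hN⟩ := exists_sub_norm_sq_mem hm p k hy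
    refine hnonneg (N := N) ?_
    rw [AlgHom.id_apply]
    convert hM.add_mem hN (hM.sq_mem y) using 1
    ring
  · obtain ⟨N, hN⟩ := exists_sub_norm_sq_mem hm p k.1
      (y := MvPolynomial.X (Sum.inr (Sum.inr k))) (fun z => by simp [yPart, k.2])
    refine hnonneg (N := N) ?_
    rw [AlgHom.id_apply]
    convert hM.add_mem hN (hM.sq_mem (MvPolynomial.X (Sum.inr (Sum.inl k.1)))) using 1
    ring

end Archimedean

/-! ### Feasible polynomials, continuity of the abscissa and L¹ estimates -/

variable {n m : ℕ}

theorem eval_nonneg_of_isSumSq {ι : Type*} {f : MvPolynomial ι ℝ} (hf : IsSumSq f) (z : ι → ℝ) :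
    0 ≤ MvPolynomial.eval z f := by
  induction hf with
  | zero => simp
  | sq_add a _ ih => rw [map_add, map_mul]; exact add_nonneg (mul_self_nonneg _) ih

theorem certificate_nonneg {hm : 0 < m} {p : Polynomial (MvPolynomial (Fin n) ℝ)}
    {z : Var n m → ℝ} (hz : z ∈ rootSet hm p)
    {σ₀ : MvPolynomial (Var n m) ℝ} {σ : Fin n → MvPolynomial (Var n m) ℝ}
    {σx : Fin m → MvPolynomial (Var n m) ℝ} (τRe τIm : ℕ → MvPolynomial (Var n m) ℝ)
    (h0 : IsSumSq σ₀) (h : ∀ j, IsSumSq (σ j)) (hx : ∀ k, k ≠ lastIdx hm → IsSumSq (σx k)) :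
    0 ≤ certificate hm p σ₀ σ σx τRe τIm z := by
  obtain ⟨hbox, hmax, heq⟩ := hz
  have hpow : ∀ k : ℕ, ((-1 : ℂ)) ^ k = (((-1 : ℝ) ^ k : ℝ) : ℂ) := fun k => by push_cast; rfl
  have he : ∀ k ∈ Finset.Icc 1 m, elemSymm k z =
      (((-1 : ℝ) ^ k * MvPolynomial.eval (qPart z) (p.coeff (m - k)) : ℝ) : ℂ) := fun k hk => by
    rw [Complex.ofReal_mul, heq k hk, ← hpow, ← mul_assoc, ← mul_pow]
    simp
  have h4 : ∑ k ∈ Finset.Icc 1 m, MvPolynomial.eval z (τRe k) *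
      ((-1) ^ k * MvPolynomial.eval (qPart z) (p.coeff (m - k)) - (elemSymm k z).re) = 0 :=
    Finset.sum_eq_zero fun k hk => by rw [he k hk, Complex.ofReal_re, sub_self, mul_zero]
  have h5 : ∑ k ∈ Finset.Icc 1 m, MvPolynomial.eval z (τIm k) * (elemSymm k z).im = 0 :=
    Finset.sum_eq_zero fun k hk => by rw [he k hk, Complex.ofReal_im, mul_zero]
  rw [certificate, h4, h5, add_zero, add_zero]
  refine add_nonneg (add_nonneg (eval_nonneg_of_isSumSq h0 z) ?_) ?_
  · refine Finset.sum_nonneg fun j _ => mul_nonneg (eval_nonneg_of_isSumSq (h j) z) ?_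
    have h1 : -1 ≤ qPart z j := hbox.1 j
    have h2 : qPart z j ≤ 1 := hbox.2 j
    nlinarith
  · refine Finset.sum_nonneg fun k hk => ?_
    have hk' := Finset.ne_of_mem_erase hk
    exact mul_nonneg (eval_nonneg_of_isSumSq (hx k hk') z) (sub_nonneg.2 (hmax k hk'))

theorem mem_rootSet_iff_forall_certModule (hm : 0 < m)
    (p : Polynomial (MvPolynomial (Fin n) ℝ)) (z : Var n m → ℝ) :
    z ∈ rootSet hm p ↔ ∀ f ∈ certModule hm p, 0 ≤ MvPolynomial.eval z f := by
  constructor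
  · rintro hz f ⟨σ₀, σ, σx, τRe, τIm, h0, h, hx, hf⟩
    rw [hf]
    exact certificate_nonneg hz τRe τIm h0 h fun k _ => hx k
  · intro h
    refine ⟨⟨fun j => ?_, fun j => ?_⟩, fun k hk => ?_, fun k hk => ?_⟩
    · have := h _ (one_sub_sq_mem_certModule hm p j)
      simp only [map_sub, map_one, map_pow, MvPolynomial.eval_X] at this
      change -1 ≤ z (Sum.inl j)
      nlinarith
    · have := h _ (one_sub_sq_mem_certModule hm p j)
      simp only [map_sub, map_one, map_pow, MvPolynomial.eval_X] at this
      change z (Sum.inl j) ≤ 1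
      nlinarith
    · have := h _ (sub_mem_certModule hm p hk)
      simpa [xPart] using this
    · obtain ⟨u, hu, v, hv, huv⟩ := isPolyFn_equation hm p hk
      have hzero : ∀ f ∈ certSupport hm p, MvPolynomial.eval z f = 0 := fun f hf => by
        have h1 := h f hf.1
        have h2 := h (-f) hf.2
        rw [map_neg] at h2
        linarith
      have h0 : (-1) ^ k * ((MvPolynomial.eval (qPart z) (p.coeff (m - k)) : ℝ) : ℂ) -
          elemSymm k z = 0 :=
        Complex.ext ((huv z).1.trans (hzero u hu)) ((huv z).2.trans (hzero v hv))
      have h8 : ((-1 : ℂ) ^ k) * (-1) ^ k = 1 := by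
        rw [← mul_pow]; simp
      linear_combination (-1) ^ k * h0 -
        ((MvPolynomial.eval (qPart z) (p.coeff (m - k)) : ℝ) : ℂ) * h8

/-- Real characters of the polynomial ring are point evaluations, and those nonnegative on the
module are the points of `rootSet`. -/
theorem mem_certModule_of_pos (hm : 0 < m) (p : Polynomial (MvPolynomial (Fin n) ℝ))
    {f : MvPolynomial (Var n m) ℝ} (hf : ∀ z ∈ rootSet hm p, 0 < MvPolynomial.eval z f) :
    f ∈ certModule hm p := by
  refine (isQuadModule_certModule hm p).mem_of_pos (archimedean_certModule hm p) fun φ hφ => ?_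
  have hz : ∀ g, φ g = MvPolynomial.eval (fun i => φ (MvPolynomial.X i)) g := fun g => by
    rw [← MvPolynomial.aeval_eq_eval]
    exact DFunLike.congr_fun (MvPolynomial.aeval_unique φ) g
  rw [hz]
  refine hf _ ((mem_rootSet_iff_forall_certModule hm p _).2 fun g hg => ?_)
  rw [← hz]
  exact hφ g hg

theorem isCompact_rootSet (hm : 0 < m) (p : Polynomial (MvPolynomial (Fin n) ℝ)) :
    IsCompact (rootSet hm p) := by
  choose N hN using fun i : Var n m => archimedean_certModule hm p (MvPolynomial.X i ^ 2)
  -- From `z_i² ≤ N_i` and `|t| ≤ 1 + t²`.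
  have hsub : rootSet hm p ⊆ Set.Icc (fun i => -(1 + N i)) (fun i => 1 + N i) := by
    intro z hz
    have key : ∀ i, z i ^ 2 ≤ N i := fun i => by
      have := (mem_rootSet_iff_forall_certModule hm p z).1 hz _ (hN i)
      rw [map_sub, MvPolynomial.algebraMap_eq, MvPolynomial.eval_C, map_pow,
        MvPolynomial.eval_X] at this
      linarith
    exact ⟨fun i => by nlinarith [key i, sq_nonneg (z i + 1 / 2)],
      fun i => by nlinarith [key i, sq_nonneg (z i - 1 / 2)]⟩
  have hclosed : IsClosed (rootSet hm p) := by
    have : rootSet hm p = ⋂ f ∈ certModule hm p, {z | 0 ≤ MvPolynomial.eval z f} := by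
      ext z
      rw [mem_rootSet_iff_forall_certModule]
      simp
    rw [this]
    exact isClosed_biInter fun f _ => isClosed_le continuous_const (MvPolynomial.continuous_eval f)
  exact isCompact_Icc.of_isClosed_subset hclosed hsub

/-- The projection of the compact `rootSet` onto the box is a quotient map, and the abscissa pulls
back along it to the coordinate `x_m`. -/
theorem continuousOn_abscissa (hm : 0 < m) {p : Polynomial (MvPolynomial (Fin n) ℝ)}
    (hp : p.Monic) (hdeg : p.natDegree = m) : ContinuousOn (abscissa p) (box n) := by
  have : CompactSpace (rootSet hm p) := isCompact_iff_compactSpace.1 (isCompact_rootSet hm p)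
  let π : rootSet hm p → box n := fun z => ⟨qPart z.1, z.2.1⟩
  have hπ : Continuous π := by
    have hc : Continuous fun z : rootSet hm p => qPart z.1 :=
      continuous_pi fun j => (continuous_apply (Sum.inl j)).comp continuous_subtype_val
    exact hc.subtype_mk _
  have hsurj : Function.Surjective π := fun q => by
    obtain ⟨z, hz, hzq⟩ := exists_mem_rootSet hm hp hdeg q.2
    exact ⟨⟨z, hz⟩, Subtype.ext hzq⟩
  have hq := hπ.isClosedMap.isQuotientMap hπ hsurj
  rw [continuousOn_iff_continuous_domRestrict, hq.continuous_iff]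
  have h1 : (box n).domRestrict (abscissa p) ∘ π = fun z => xPart z.1 (lastIdx hm) := by
    funext z
    exact (xPart_last_eq_abscissa hm hp hdeg z.2).symm
  rw [h1]
  exact (continuous_apply _).comp continuous_subtype_val

/-- Multivariate Weierstrass approximation on a compact set. -/
theorem exists_mvPolynomial_near {ι : Type*} {K : Set (ι → ℝ)} (hK : IsCompact K)
    {g : (ι → ℝ) → ℝ} (hg : ContinuousOn g K) {ε : ℝ} (hε : 0 < ε) :
    ∃ w : MvPolynomial ι ℝ, ∀ q ∈ K, |MvPolynomial.eval q w - g q| < ε := by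
  have : CompactSpace K := isCompact_iff_compactSpace.1 hK
  let c : ι → C(K, ℝ) := fun i => ⟨fun q => q.1 i, (continuous_apply i).comp continuous_subtype_val⟩
  let Φ : MvPolynomial ι ℝ →ₐ[ℝ] C(K, ℝ) := MvPolynomial.aeval c
  have hΦ : ∀ (f : MvPolynomial ι ℝ) (q : K), Φ f q = MvPolynomial.eval q.1 f := fun f q => by
    induction f using MvPolynomial.induction_on with
    | C a => simp [Φ]
    | add f g hf hg => rw [map_add, ContinuousMap.add_apply, hf, hg, map_add]
    | mul_X f i hf =>
      rw [map_mul, ContinuousMap.mul_apply, hf, map_mul, MvPolynomial.eval_X]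
      simp [Φ, c]
  have hsep : Φ.range.SeparatesPoints := by
    intro x y hxy
    obtain ⟨i, hi⟩ := Function.ne_iff.1 fun h => hxy (Subtype.ext h)
    exact ⟨_, ⟨Φ (MvPolynomial.X i), ⟨_, rfl⟩, rfl⟩, by simpa [hΦ] using hi⟩
  obtain ⟨⟨_, w, rfl⟩, hw⟩ := ContinuousMap.exists_mem_subalgebra_near_continuous_of_separatesPoints
    Φ.range hsep (K.domRestrict g) (continuousOn_iff_continuous_domRestrict.1 hg) ε hε
  exact ⟨w, fun q hq => by
    have := hw ⟨q, hq⟩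
    change |Φ w ⟨q, hq⟩ - g q| < ε at this
    rwa [hΦ] at this⟩

theorem IsFeasible.eval_le_abscissa {hm : 0 < m} {p : Polynomial (MvPolynomial (Fin n) ℝ)}
    (hp : p.Monic) (hdeg : p.natDegree = m) {d : ℕ} {w : MvPolynomial (Fin n) ℝ}
    (hw : IsFeasible hm p d w) {q : Fin n → ℝ} (hq : q ∈ box n) :
    MvPolynomial.eval q w ≤ abscissa p q := by
  obtain ⟨z, hz, rfl⟩ := exists_mem_rootSet hm hp hdeg hq
  obtain ⟨-, σ₀, σ, σx, τRe, τIm, h0, h, hx, -, -, heq⟩ := hw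
  have h1 := certificate_nonneg hz τRe τIm h0.1 (fun j => (h j).1) fun k hk => (hx k hk).1
  rw [certificate, ← heq z, xPart_last_eq_abscissa hm hp hdeg hz] at h1
  linarith

/-- A polynomial below the abscissa is feasible from some order on. -/
theorem exists_forall_isFeasible (hm : 0 < m) {p : Polynomial (MvPolynomial (Fin n) ℝ)}
    (hp : p.Monic) (hdeg : p.natDegree = m) {w : MvPolynomial (Fin n) ℝ}
    (hw : ∀ q ∈ box n, MvPolynomial.eval q w < abscissa p q) :
    ∃ d₀, ∀ d ≥ d₀, IsFeasible hm p d w := by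
  obtain ⟨σ₀, σ, σx, τRe, τIm, h0, h, hx, hf⟩ := mem_certModule_of_pos hm p
    (f := MvPolynomial.X (Sum.inr (Sum.inl (lastIdx hm))) - MvPolynomial.rename Sum.inl w)
    fun z hz => by
      rw [map_sub, eval_rename_inl, MvPolynomial.eval_X, sub_pos]
      exact (hw _ hz.1).trans_eq (xPart_last_eq_abscissa hm hp hdeg hz).symm
  set b := ∑ j, (σ j).totalDegree with hb
  set bx := ∑ k, (σx k).totalDegree with hbx
  set bR := ∑ k ∈ Finset.Icc 1 m, (τRe k).totalDegree with hbR
  set bI := ∑ k ∈ Finset.Icc 1 m, (τIm k).totalDegree with hbI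
  -- The sum dominates every degree; `m` and `2` make room for the subtractions in `2d - k` and `2d
  -- - 2`.
  refine ⟨w.totalDegree + σ₀.totalDegree + b + bx + bR + bI + m + 2, fun d hd =>
    ⟨by omega, σ₀, σ, σx, τRe, τIm, ⟨h0, by omega⟩, fun j => ⟨h j, ?_⟩, fun k _ => ⟨hx k, ?_⟩,
      fun k hk => ?_, fun k hk => ?_, fun z => ?_⟩⟩
  · have : (σ j).totalDegree ≤ b := Finset.single_le_sum (f := fun j => (σ j).totalDegree)
      (fun _ _ => Nat.zero_le _) (Finset.mem_univ j)
    omega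
  · have : (σx k).totalDegree ≤ bx := Finset.single_le_sum (f := fun j => (σx j).totalDegree)
      (fun _ _ => Nat.zero_le _) (Finset.mem_univ k)
    omega
  · have : (τRe k).totalDegree ≤ bR := Finset.single_le_sum (f := fun j => (τRe j).totalDegree)
      (fun _ _ => Nat.zero_le _) hk
    have := (Finset.mem_Icc.1 hk).2
    omega
  · have : (τIm k).totalDegree ≤ bI := Finset.single_le_sum (f := fun j => (τIm j).totalDegree)
      (fun _ _ => Nat.zero_le _) hk
    have := (Finset.mem_Icc.1 hk).2
    omega
  · have := hf z
    rw [map_sub, eval_rename_inl, MvPolynomial.eval_X] at this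
    exact this

theorem isCompact_box (n : ℕ) : IsCompact (box n) := isCompact_Icc

theorem integrableOn_eval (w : MvPolynomial (Fin n) ℝ) :
    IntegrableOn (fun q => MvPolynomial.eval q w) (box n) :=
  (MvPolynomial.continuous_eval w).continuousOn.integrableOn_compact (isCompact_box n)

theorem integrableOn_abscissa (hm : 0 < m) {p : Polynomial (MvPolynomial (Fin n) ℝ)}
    (hp : p.Monic) (hdeg : p.natDegree = m) : IntegrableOn (abscissa p) (box n) :=
  (continuousOn_abscissa hm hp hdeg).integrableOn_compact (isCompact_box n)

theorem IsFeasible.objective_le {hm : 0 < m} {p : Polynomial (MvPolynomial (Fin n) ℝ)}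
    (hp : p.Monic) (hdeg : p.natDegree = m) {d : ℕ} {w : MvPolynomial (Fin n) ℝ}
    (hw : IsFeasible hm p d w) : objective w ≤ ∫ q in box n, abscissa p q :=
  setIntegral_mono_on (integrableOn_eval w) (integrableOn_abscissa hm hp hdeg)
    measurableSet_Icc fun _ hq => hw.eval_le_abscissa hp hdeg hq

theorem bddAbove_values (hm : 0 < m) {p : Polynomial (MvPolynomial (Fin n) ℝ)}
    (hp : p.Monic) (hdeg : p.natDegree = m) (d : ℕ) : BddAbove (values hm p d) :=
  ⟨_, by rintro _ ⟨w, hw, rfl⟩; exact IsFeasible.objective_le hp hdeg hw⟩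

/-- The optimal values converge to the integral of the abscissa from below. -/
theorem exists_forall_isFeasible_objective_ge (hm : 0 < m)
    {p : Polynomial (MvPolynomial (Fin n) ℝ)} (hp : p.Monic) (hdeg : p.natDegree = m)
    {ε : ℝ} (hε : 0 < ε) : ∃ d₀ : ℕ, ∃ w : MvPolynomial (Fin n) ℝ,
      (∀ d ≥ d₀, IsFeasible hm p d w) ∧ (∫ q in box n, abscissa p q) - ε ≤ objective w := by
  set V := volume.real (box n) with hV
  have hV0 : 0 ≤ V := measureReal_nonneg
  -- Approximating `a - δ` within `δ` keeps `w` strictly between `a - 2δ` and `a`, at a cost of at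
  -- most `2δV ≤ ε`.
  set δ := ε / (2 * (V + 1)) with hδ
  have hδ0 : 0 < δ := by positivity
  obtain ⟨w, hw⟩ := exists_mvPolynomial_near (isCompact_box n)
    ((continuousOn_abscissa hm hp hdeg).sub (continuousOn_const (c := δ))) hδ0
  have hw' : ∀ q ∈ box n, MvPolynomial.eval q w < abscissa p q ∧
      abscissa p q - 2 * δ ≤ MvPolynomial.eval q w := fun q hq => by
    have := abs_lt.1 (hw q hq)
    rw [Pi.sub_apply] at this
    constructor <;> linarith
  obtain ⟨d₀, hd₀⟩ := exists_forall_isFeasible hm hp hdeg fun q hq => (hw' q hq).1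
  refine ⟨d₀, w, hd₀, ?_⟩
  have hfin : volume (box n) ≠ ⊤ := (isCompact_box n).measure_ne_top
  have hconst : IntegrableOn (fun _ : Fin n → ℝ => 2 * δ) (box n) := integrableOn_const hfin
  have h1 : ∫ q in box n, (abscissa p q - 2 * δ) ≤ objective w :=
    setIntegral_mono_on ((integrableOn_abscissa hm hp hdeg).sub hconst) (integrableOn_eval w)
      measurableSet_Icc fun q hq => (hw' q hq).2
  rw [integral_sub (integrableOn_abscissa hm hp hdeg) hconst, setIntegral_const, ← hV,
    smul_eq_mul] at h1
  have h2 : V * (2 * δ) ≤ ε := by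
    rw [hδ, mul_comm 2 (ε / _), mul_comm 2 (V + 1), ← div_div, div_mul_cancel₀ _ two_ne_zero,
      mul_div_assoc', div_le_iff₀ (by positivity)]
    nlinarith
  linarith

/-- Since `w ≤ a` on the box, `|w - a| = a - w` there. -/
theorem eLpNorm_sub_abscissa {hm : 0 < m} {p : Polynomial (MvPolynomial (Fin n) ℝ)}
    (hp : p.Monic) (hdeg : p.natDegree = m) {d : ℕ} {w : MvPolynomial (Fin n) ℝ}
    (hw : IsFeasible hm p d w) :
    eLpNorm (fun q => MvPolynomial.eval q w - abscissa p q) 1 (volume.restrict (box n)) =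
      ENNReal.ofReal ((∫ q in box n, abscissa p q) - objective w) := by
  have hint : IntegrableOn (fun q => MvPolynomial.eval q w - abscissa p q) (box n) :=
    (integrableOn_eval w).sub (integrableOn_abscissa hm hp hdeg)
  rw [eLpNorm_one_eq_lintegral_enorm, ← ofReal_integral_norm_eq_lintegral_enorm hint, objective,
    ← integral_sub (integrableOn_abscissa hm hp hdeg) (integrableOn_eval w)]
  congr 1
  refine setIntegral_congr_fun measurableSet_Icc fun q hq => ?_
  have := hw.eval_le_abscissa hp hdeg hq
  simp only [Real.norm_eq_abs]
  rw [abs_sub_comm, abs_of_nonneg (by linarith)]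

end AbscissaLower

theorem mainTheorem3 {n m : ℕ} (hm : 0 < m) (p : Polynomial (MvPolynomial (Fin n) ℝ))
    (hp : p.Monic) (hdeg : p.natDegree = m) :
    -- `Z_o` lies over the whole box, and its coordinate `x_m` is the abscissa
    (∀ q ∈ AbscissaLower.box n,
      (∃ z ∈ AbscissaLower.rootSet hm p, AbscissaLower.qPart z = q) ∧
      ∀ z ∈ AbscissaLower.rootSet hm p, AbscissaLower.qPart z = q →
        AbscissaLower.xPart z (AbscissaLower.lastIdx hm) = AbscissaLower.abscissa p q) ∧
    -- the abscissa is integrable over the box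
    MemLp (AbscissaLower.abscissa p) 1 (volume.restrict (AbscissaLower.box n)) ∧
    ∃ D : ℕ, 1 ≤ D ∧ m ≤ 2 * D ∧
      -- from some order on, the optimal value is finite and near optimal solutions exist
      (∀ d ≥ D, (AbscissaLower.values hm p d).Nonempty ∧
        BddAbove (AbscissaLower.values hm p d) ∧
        ∃ w, AbscissaLower.IsNearOptimal hm p d w) ∧
      -- near optimal solutions are lower bounds and converge to the abscissa in `L¹`
      ∀ d₀ ≥ D, ∀ w : ℕ → MvPolynomial (Fin n) ℝ,
        (∀ d ≥ d₀, AbscissaLower.IsNearOptimal hm p d (w d)) →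
        (∀ d ≥ d₀, ∀ q ∈ AbscissaLower.box n,
          MvPolynomial.eval q (w d) ≤ AbscissaLower.abscissa p q) ∧
        Tendsto (fun d => eLpNorm
            (fun q => MvPolynomial.eval q (w d) - AbscissaLower.abscissa p q) 1
            (volume.restrict (AbscissaLower.box n))) atTop (𝓝 0) := by
  refine ⟨fun q hq => ⟨AbscissaLower.exists_mem_rootSet hm hp hdeg hq, fun z hz hzq => ?_⟩,
    memLp_one_iff_integrable.2 (AbscissaLower.integrableOn_abscissa hm hp hdeg), ?_⟩
  · rw [← hzq]
    exact AbscissaLower.xPart_last_eq_abscissa hm hp hdeg hz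
  -- Only feasibility of `w₁` from order `d₁` on matters here; the accuracy `1` is arbitrary.
  obtain ⟨d₁, w₁, hw₁, -⟩ :=
    AbscissaLower.exists_forall_isFeasible_objective_ge hm hp hdeg one_pos
  refine ⟨d₁ + m, by omega, by omega, fun d hd => ?_, fun d₀ hd₀ w hw => ?_⟩
  · have hne : (AbscissaLower.values hm p d).Nonempty := ⟨_, w₁, hw₁ d (by omega), rfl⟩
    have hd0 : (0 : ℝ) < 1 / d := by
      have : 0 < d := by omega
      positivity
    obtain ⟨_, ⟨w, hw, rfl⟩, hlt⟩ := exists_lt_of_lt_csSup hne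
      (sub_lt_self (AbscissaLower.optVal hm p d) hd0)
    exact ⟨hne, AbscissaLower.bddAbove_values hm hp hdeg d, w, hw, hlt.le⟩
  · refine ⟨fun d hd q hq => (hw d hd).1.eval_le_abscissa hp hdeg hq, ?_⟩
    have hlim : Tendsto (fun d => (∫ q in AbscissaLower.box n, AbscissaLower.abscissa p q) -
        AbscissaLower.objective (w d)) atTop (𝓝 0) := by
      rw [Metric.tendsto_atTop]
      intro ε hε
      obtain ⟨d₂, w₂, hw₂, hge⟩ :=
        AbscissaLower.exists_forall_isFeasible_objective_ge hm hp hdeg (half_pos hε)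
      -- One half of `ε` covers the gap between `∫ a` and the optimal value, the other the tolerance
      -- `1 / d`.
      obtain ⟨d₃, hd₃⟩ := exists_nat_gt (2 / ε)
      refine ⟨d₀ + d₂ + d₃, fun d hd => ?_⟩
      obtain ⟨hfeas, hopt⟩ := hw d (by omega)
      have h1 := hfeas.objective_le hp hdeg
      have h2 : AbscissaLower.objective w₂ ≤ AbscissaLower.optVal hm p d :=
        le_csSup (AbscissaLower.bddAbove_values hm hp hdeg d) ⟨w₂, hw₂ d (by omega), rfl⟩
      have h3 : (2 / ε : ℝ) < d := hd₃.trans_le (by exact_mod_cast (by omega : d₃ ≤ d))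
      have h4 : 1 / (d : ℝ) < ε / 2 := by
        have := one_div_lt_one_div_of_lt (by positivity) h3
        rwa [one_div_div] at this
      rw [Real.dist_eq, sub_zero, abs_of_nonneg (by linarith)]
      linarith
    have h5 := ENNReal.tendsto_ofReal hlim
    rw [ENNReal.ofReal_zero] at h5
    refine h5.congr' ?_
    filter_upwards [eventually_ge_atTop d₀] with d hd
    exact (AbscissaLower.eLpNorm_sub_abscissa hp hdeg (hw d hd).1).symm
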